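/- Let $x_1,\dots,x_N\in\mathbb{R}^d$, let $\mathcal S$ be the collection of all $K$-element subsets of $\{1,\dots,N\}$, and for $S\in\mathcal S$ let $A_S$ be the matrix with $d$ rows whose columns are $z_{j,k}=x_j-x_k$ for $j<k$, $j,k\in S$. For $\pi$ in the simplex $\Delta^{\mathcal S}$ of probability distributions on $\mathcal S$ put $V_\pi=\sum_{S}\pi(S)A_SA_S^\top$ and $g(\pi)=\log\det V_\pi$ (with $g(\pi)=-\infty$ if $V_\pi$ is singular). Let $1\le R\le\binom NK$ and let $\pi_0\in\Delta^{\mathcal S}$ be such that $V_{\pi_0}$ has full rank $d$. DopeWolfe with regularization $\gamma=0$ and line-search tolerance $\alpha_{\rm tol}>0$ starts from $\pi_0$ and $V_0^{\rm inv}=V_{\pi_0}^{-1}$. At iteration $t=0,1,\dots$ it draws, independently of the past, a collection $\mathcal R_t$ uniformly at random from all $R$-element sub-collections of $\mathcal S$; computes $G_t(S)=\sum_{j<k;\,j,k\in S}z_{j,k}^\top V_t^{\rm inv}z_{j,k}$ for $S\in\mathcal R_t$; picks $S_t\in\arg\max_{S\in\mathcal R_t}G_t(S)$ (ties broken arbitrarily,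 without looking into the future); computes $\alpha_t$ by golden-section search on $[0,1]$ (returning the midpoint of the first interval of length less than $\alpha_{\rm tol}$) for the maximization of $$\alpha\mapsto d\log(1-\alpha)+\log\det\bigl(I+\tilde A^\top\tilde V\tilde A\bigr),\qquad \tilde V=V_t^{\rm inv}/(1-\alpha),\quad \tilde A=\sqrt{\alpha}\,A_{S_t};$$ and sets, with $\alpha=\alpha_t$ in $\tilde V,\tilde A$, $\pi_{t+1}=(1-\alpha_t)\pi_t+\alpha_te_{S_t}$ and $V_{t+1}^{\rm inv}=\tilde V-\tilde V\tilde A(I+\tilde A^\top\tilde V\tilde A)^{-1}\tilde A^\top\tilde V$. Then $g$ attains its maximum over $\Delta^{\mathcal S}$. Let $\delta_0=\max_{\pi\in\Delta^{\mathcal S}}g(\pi)-g(\pi_0)$, let $\varepsilon>0$, and let $$B=\frac{\binom NK}{R}\Bigl(5.3\,(\delta_0+d)\max\Bigl\{\ln\frac{\delta_0}{\varepsilon},0\Bigr\}+12\,d^2\max\Bigl\{\frac1\varepsilon-\frac1{\delta_0},0\Bigr\}\Bigr)$$ (if $\delta_0=0$, the terms $\ln(\delta_0/\varepsilon)$ and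 $1/\delta_0$ are read as $0$). Then $$B\le\bigl(12d^2+5.3\,\delta_0(\delta_0+d)\bigr)\,\max\Bigl\{1,\tfrac{\binom NK}{R}\Bigr\}\,\varepsilon^{-1},$$ and for every integer $T\ge B$ the following holds for all small enough $\alpha_{\rm tol}$ (that is, for all $0<\alpha_{\rm tol}\le\alpha^*$, where $\alpha^*>0$ does not depend on the random run or on the tie breaking): almost surely $\pi_T\in\Delta^{\mathcal S}$ and $V_{\pi_T}$ is positive definite, $g(\pi_T)$ is integrable, and $$\max_{\pi\in\Delta^{\mathcal S}}g(\pi)-\mathbb E[g(\pi_T)]\le\varepsilon .$$ In particular, DopeWolfe reaches expected suboptimality $\varepsilon$ after $T=\lceil B\rceil$ iterations, that is, after $O\bigl(\max(1,\binom NK/R)\,\varepsilon^{-1}\bigr)$ iterations, where the constant depends only on $d$ and $\delta_0$. -/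

import Mathlib

open MeasureTheory
open scoped Matrix

noncomputable section

namespace DopeWolfe

variable {N d K : ℕ}

/-- The collection `𝒮` of all subsets of size `K` of the `N` items. -/
abbrev KSubset (N K : ℕ) : Type := {S : Finset (Fin N) // S.card = K}

/-- The pairs `(j, k)` with `j < k` and `j, k ∈ S`. -/
abbrev PairIn (S : Finset (Fin N)) : Type :=
  {p : Fin N × Fin N // p.1 < p.2 ∧ p.1 ∈ S ∧ p.2 ∈ S}

/-- The feature difference `z_{j,k} = x_j - x_k`. -/
def featDiff (x : Fin N → Fin d → ℝ) (p : Fin N × Fin N) : Fin d → ℝ := x p.1 - x p.2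

/-- The matrix `A_S`, with `d` rows, whose columns are the `z_{j,k}` for the pairs in `S`. -/
def featMatrix (x : Fin N → Fin d → ℝ) (S : Finset (Fin N)) : Matrix (Fin d) (PairIn S) ℝ :=
  Matrix.of fun i p => featDiff x p.1 i

/-- `V_π = ∑_S π(S) A_S A_Sᵀ`. -/
def designMatrix (x : Fin N → Fin d → ℝ) (π : KSubset N K → ℝ) : Matrix (Fin d) (Fin d) ℝ :=
  ∑ S : KSubset N K, π S • (featMatrix x S.1 * (featMatrix x S.1)ᵀ)

/-- The objective `g(π) = log det V_π`. It is only used where `V_π` is positive definite;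
elsewhere on the simplex `V_π` is singular and the mathematical value is `-∞`. -/
def objective (x : Fin N → Fin d → ℝ) (π : KSubset N K → ℝ) : ℝ :=
  Real.log (designMatrix x π).det

/-- `π` maximizes `g` over the simplex of all probability distributions on `𝒮`
(points with singular `V`, where `g = -∞`, neither are maximizers nor compete). -/
structure IsDOptimal (x : Fin N → Fin d → ℝ) (π : KSubset N K → ℝ) : Prop where
  mem : π ∈ stdSimplex ℝ (KSubset N K)
  posDef : (designMatrix x π).PosDef
  le : ∀ π' ∈ stdSimplex ℝ (KSubset N K), (designMatrix x π').PosDef →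
    objective x π' ≤ objective x π

/-! The sub-routines of the algorithm. -/

/-- Sub-routine `PartialGrad`: `G(S) = ∑_{(j,k)} z_{j,k}ᵀ V^inv z_{j,k}` over the pairs in `S`. -/
def partialGrad (x : Fin N → Fin d → ℝ) (Vinv : Matrix (Fin d) (Fin d) ℝ)
    (S : Finset (Fin N)) : ℝ :=
  ∑ p : PairIn S, featDiff x p.1 ⬝ᵥ (Vinv *ᵥ featDiff x p.1)

/-- Sub-routine `UpdateLogDet`: the change of the objective along a step of size `α`, as the
`log det` of an `r × r` matrix, where `r` is the number of columns of `A`. -/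
def updateLogDet {r : Type} [Fintype r] [DecidableEq r] (Vinv : Matrix (Fin d) (Fin d) ℝ)
    (A : Matrix (Fin d) r ℝ) (α : ℝ) : ℝ :=
  let Vt : Matrix (Fin d) (Fin d) ℝ := (1 - α)⁻¹ • Vinv
  let At : Matrix (Fin d) r ℝ := Real.sqrt α • A
  (d : ℝ) * Real.log (1 - α) + Real.log (1 + Atᵀ * Vt * At).det

/-- Sub-routine `UpdateInverse`: the low-rank (Woodbury) update of the inverse. -/
def updateInverse {r : Type} [Fintype r] [DecidableEq r] (Vinv : Matrix (Fin d) (Fin d) ℝ)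
    (A : Matrix (Fin d) r ℝ) (α : ℝ) : Matrix (Fin d) (Fin d) ℝ :=
  let Vt : Matrix (Fin d) (Fin d) ℝ := (1 - α)⁻¹ • Vinv
  let At : Matrix (Fin d) r ℝ := Real.sqrt α • A
  Vt - Vt * At * (1 + Atᵀ * Vt * At)⁻¹ * Atᵀ * Vt

/-- The variables of the golden-section search: the current interval `[a, b]`, the two interior
points `c, d`, and the current length `h`. -/
structure GoldenState where
  a : ℝ
  b : ℝ
  c : ℝ
  d : ℝ
  h : ℝ

/-- Initial variables of the search on `[0, 1]`. -/
def goldenInit : GoldenState where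
  a := 0
  b := 1
  c := (Real.goldenRatio ^ 2)⁻¹
  d := Real.goldenRatio⁻¹
  h := 1

open Classical in
/-- One pass through the loop of the golden-section search for maximizing `f`. -/
def goldenStep (f : ℝ → ℝ) (s : GoldenState) : GoldenState :=
  let h' := s.h * Real.goldenRatio⁻¹
  if f s.c > f s.d then
    { a := s.a, b := s.d, c := s.a + h' * (Real.goldenRatio ^ 2)⁻¹, d := s.c, h := h' }
  else
    { a := s.c, b := s.b, c := s.d, d := s.c + h' * Real.goldenRatio⁻¹, h := h' }

/-- The number of passes through `while |a - b| ≥ tol`: the first `n` such that the condition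
fails after `n` passes (it exists if `tol > 0`, as `|a - b|` shrinks by the golden ratio). -/
def goldenPasses (f : ℝ → ℝ) (tol : ℝ) : ℕ :=
  sInf {n : ℕ | |((goldenStep f)^[n] goldenInit).a - ((goldenStep f)^[n] goldenInit).b| < tol}

/-- Sub-routine `GoldenSearch` for maximizing `f` on `[0, 1]` with tolerance `tol`: the midpoint
of the final interval. -/
def goldenSearch (f : ℝ → ℝ) (tol : ℝ) : ℝ :=
  let s := (goldenStep f)^[goldenPasses f tol] goldenInit
  (s.a + s.b) / 2

/-! The main loop. -/

/-- What the algorithm maintains: the iterate `π_t` and the matrix `V_t^inv`. -/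
structure State (N d K : ℕ) where
  iter : KSubset N K → ℝ
  Vinv : Matrix (Fin d) (Fin d) ℝ

/-- The initial state, with `V_0^inv = (V_{π₀} + γ I)⁻¹`. -/
def initState (x : Fin N → Fin d → ℝ) (π₀ : KSubset N K → ℝ) (γ : ℝ) : State N d K where
  iter := π₀
  Vinv := (designMatrix x π₀ + γ • (1 : Matrix (Fin d) (Fin d) ℝ))⁻¹

/-- The line search and the two updates, once the subset `S_t = S` has been chosen. -/
def step (x : Fin N → Fin d → ℝ) (tol : ℝ) (s : State N d K) (S : KSubset N K) : State N d K :=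
  let α := goldenSearch (updateLogDet s.Vinv (featMatrix x S.1)) tol
  { iter := (1 - α) • s.iter + α • Pi.single S 1
    Vinv := updateInverse s.Vinv (featMatrix x S.1) α }

/-- The state at the beginning of iteration `t`, if `S_0, S_1, …` are the chosen subsets. -/
def stateAt (x : Fin N → Fin d → ℝ) (π₀ : KSubset N K → ℝ) (γ tol : ℝ)
    (chosen : ℕ → KSubset N K) : ℕ → State N d K
  | 0 => initState x π₀ γ
  | t + 1 => step x tol (stateAt x π₀ γ tol chosen t) (chosen t)

/-- `samples t = 𝓡_t` and `chosen t = S_t` are the random collections and subsets of a run of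
DopeWolfe: given everything sampled and chosen before, `𝓡_t` is uniformly distributed on the
collections of `R` subsets, and `S_t` is a maximizer of `G_t` over `𝓡_t` (ties may be broken
in any way, possibly at random). -/
structure IsRun (x : Fin N → Fin d → ℝ) (R : ℕ) (π₀ : KSubset N K → ℝ) (γ tol : ℝ)
    {Ω : Type*} [MeasurableSpace Ω] (μ : Measure Ω)
    (samples : ℕ → Ω → Finset (KSubset N K)) (chosen : ℕ → Ω → KSubset N K) : Prop where
  measurable_samples : ∀ t 𝓡, MeasurableSet {ω | samples t ω = 𝓡}
  measurable_chosen : ∀ t S, MeasurableSet {ω | chosen t ω = S}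
  uniform : ∀ (t : ℕ) (r : ℕ → Finset (KSubset N K)) (s : ℕ → KSubset N K)
    (𝓡 : Finset (KSubset N K)), 𝓡.card = R →
      μ ({ω | ∀ i < t, samples i ω = r i ∧ chosen i ω = s i} ∩ {ω | samples t ω = 𝓡}) =
        μ {ω | ∀ i < t, samples i ω = r i ∧ chosen i ω = s i} /
          (((N.choose K).choose R : ℕ) : ENNReal)
  argmax : ∀ᵐ ω ∂μ, ∀ t, chosen t ω ∈ samples t ω ∧
    ∀ S ∈ samples t ω,
      partialGrad x (stateAt x π₀ γ tol (fun i => chosen i ω) t).Vinv S.1 ≤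
        partialGrad x (stateAt x π₀ γ tol (fun i => chosen i ω) t).Vinv (chosen t ω).1

/-- The number of iterations (before rounding up), where `δ₀` is the initial optimality gap. -/
def iterationBound (N d K R : ℕ) (δ₀ ε : ℝ) : ℝ :=
  ((N.choose K : ℝ) / R) *
    (5.3 * (δ₀ + d) * max (Real.log (δ₀ / ε)) 0 + 12 * (d : ℝ) ^ 2 * max (1 / ε - 1 / δ₀) 0)

end DopeWolfe

end

noncomputable section

namespace DopeWolfe

/-! Let `πs` be optimal and let δ be the current gap g(πs) - g(π_t). The tangent inequality for `log
det` at V_{π_t} shows that the average of G_t under `πs` is at least d + δ, so some subset S* has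
G_t(S*) ≥ d + δ (`exists_partialGrad_ge`). This S* is a function of the past, and the fresh sample
contains it with probability at least ρ = R / C(N, K) (`le_measureReal_history_mem`). If it does,
the chosen S_t scores at least as high, and some step towards S_t gains p(δ) = δ² / ((δ + d)(δ +
2d)) (`exists_step_progress`). If it does not, the step 0 is still a competitor that loses nothing.

The line search is inexact. Along a segment g is concave on [0, 1), so golden section ends within
the tolerance of a point no worse than any prescribed competitor (`exists_ge_near_goldenSearch`).
Where the determinant is bounded below, g is uniformly continuous, and a loss of at most η per
iteration keeps the first T iterates in such a region. Hence one tolerance serves all runs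
(`exists_tolerance`).

For expectations, p is bounded and so not convex on the half-line. The control on losses keeps δ ≤
δ₀ + d/2, and there p(u) ≥ (3/2) u² / (a u + b) with a = 5.3 (δ₀ + d) and b = 12 d². The right side
is convex, so the expected gaps satisfy e_{t+1} ≤ e_t + η - (3/2) ρ e_t² / (a e_t + b)
(`integral_objective_step`). As long as the gap exceeds ε, a third of the decrement pays for η and
the rest raises b/e - a log e by ρ per iteration; T ≥ B iterations exhaust this potential
(`le_of_decrement`). -/

theorem segment_posDef {n : Type*} {V B : Matrix n n ℝ} (hV : V.PosDef) (hB : B.PosSemidef)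
    {α : ℝ} (h0 : 0 ≤ α) (h1 : α < 1) :
    ((1 - α) • V + α • B).PosDef :=
  (hV.smul (sub_pos.2 h1)).add_posSemidef (hB.smul h0)

/-! ### The function `log det` along a segment. -/

section LogDet

variable {n : Type*} [Fintype n] [DecidableEq n] {V B : Matrix n n ℝ}

open scoped MatrixOrder Matrix.Norms.L2Operator in
-- Congruence by the inverse of this factor turns V into the identity, so a pencil in V and B
-- reduces to the spectrum of one symmetric matrix.
theorem exists_eq_conjTranspose_mul_self (hV : V.PosDef) :
    ∃ C : Matrix n n ℝ, IsUnit C ∧ V = Cᴴ * C := by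
  obtain ⟨C, rfl⟩ := CStarAlgebra.nonneg_iff_eq_star_mul_self.mp hV.posSemidef.nonneg
  refine ⟨C, ?_, rfl⟩
  have h := hV.det_pos
  rw [Matrix.star_eq_conjTranspose, Matrix.det_mul] at h
  rw [Matrix.isUnit_iff_isUnit_det, isUnit_iff_ne_zero]
  exact right_ne_zero_of_mul h.ne'

theorem det_smul_one_add_smul (hB : B.IsHermitian) (s t : ℝ) :
    (s • (1 : Matrix n n ℝ) + t • B).det = ∏ i, (s + t * hB.eigenvalues i) := by
  have h1 : s • (1 : Matrix n n ℝ) + t • B =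
      Unitary.conjStarAlgAut ℝ _ hB.eigenvectorUnitary
        (Matrix.diagonal fun i => s + t * hB.eigenvalues i) := by
    have h2 : (Matrix.diagonal fun i => s + t * hB.eigenvalues i) =
        s • (1 : Matrix n n ℝ) + t • Matrix.diagonal (RCLike.ofReal ∘ hB.eigenvalues) := by
      ext i j
      by_cases hij : i = j
      · subst hij; simp
      · simp [hij]
    rw [h2, map_add, map_smul, map_smul, map_one, ← hB.spectral_theorem]
  rw [h1, Unitary.conjStarAlgAut_apply, Matrix.det_mul_right_comm,
    Unitary.mul_star_self_of_mem hB.eigenvectorUnitary.2, one_mul, Matrix.det_diagonal]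

/-- The generalized eigenvalues of the pencil `s V + t B`. -/
theorem exists_relative_eigenvalues (hV : V.PosDef) (hB : B.PosSemidef) :
    ∃ l : n → ℝ, (∀ i, 0 ≤ l i) ∧
      (∀ s t : ℝ, (s • V + t • B).det = V.det * ∏ i, (s + t * l i)) ∧
      (V⁻¹ * B).trace = ∑ i, l i := by
  obtain ⟨C, hC, rfl⟩ := exists_eq_conjTranspose_mul_self hV
  have hCd : IsUnit C.det := (Matrix.isUnit_iff_isUnit_det _).1 hC
  have hM : ((C⁻¹)ᴴ * B * C⁻¹).PosSemidef := hB.conjTranspose_mul_mul_same _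
  have hCH : Cᴴ * (C⁻¹)ᴴ = 1 := by
    rw [← Matrix.conjTranspose_mul, Matrix.nonsing_inv_mul _ hCd, Matrix.conjTranspose_one]
  refine ⟨hM.1.eigenvalues, hM.eigenvalues_nonneg, fun s t => ?_, ?_⟩
  · have h : s • (Cᴴ * C) + t • B =
        Cᴴ * (s • (1 : Matrix n n ℝ) + t • ((C⁻¹)ᴴ * B * C⁻¹)) * C := by
      rw [Matrix.mul_add, Matrix.add_mul]
      congr 1
      · simp
      · simp only [Matrix.mul_smul, Matrix.smul_mul]
        congr 1
        calc B = (Cᴴ * (C⁻¹)ᴴ) * B * (C⁻¹ * C) := by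
              rw [hCH, Matrix.nonsing_inv_mul _ hCd, Matrix.one_mul, Matrix.mul_one]
          _ = _ := by simp only [Matrix.mul_assoc]
    rw [h, Matrix.det_mul, Matrix.det_mul, det_smul_one_add_smul hM.1, Matrix.det_mul]
    ring
  · have h := hM.1.trace_eq_sum_eigenvalues
    simp only [RCLike.ofReal_real_eq_id, id] at h
    rw [← h, Matrix.mul_inv_rev, ← Matrix.conjTranspose_nonsing_inv, Matrix.trace_mul_comm,
      ← Matrix.mul_assoc, Matrix.trace_mul_comm, Matrix.mul_assoc]

/-- In terms of the generalized eigenvalues the function is a constant plus a sum of logarithms of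
positive affine functions of α. The endpoint 1 is excluded because B may be singular. -/
theorem concaveOn_log_det (hV : V.PosDef) (hB : B.PosSemidef) :
    ConcaveOn ℝ (Set.Ico (0 : ℝ) 1) fun α => Real.log ((1 - α) • V + α • B).det := by
  obtain ⟨l, hl, hdet, -⟩ := exists_relative_eigenvalues hV hB
  have hpos : ∀ α ∈ Set.Ico (0 : ℝ) 1, ∀ i, 0 < 1 - α + α * l i := fun α hα i => by
    have := mul_nonneg hα.1 (hl i)
    linarith [hα.2]
  have hlog : ∀ α ∈ Set.Ico (0 : ℝ) 1, Real.log ((1 - α) • V + α • B).det =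
      Real.log V.det + ∑ i, Real.log (1 - α + α * l i) := fun α hα => by
    rw [hdet, Real.log_mul hV.det_pos.ne' (Finset.prod_ne_zero_iff.2 fun i _ => (hpos α hα i).ne'),
      Real.log_prod fun i _ => (hpos α hα i).ne']
  refine ⟨convex_Ico _ _, fun x hx y hy a b ha hb hab => ?_⟩
  have hxy := convex_Ico (0 : ℝ) 1 hx hy ha hb hab
  simp only
  rw [hlog x hx, hlog y hy, hlog _ hxy]
  simp only [smul_eq_mul]
  have key : ∑ i, (a * Real.log (1 - x + x * l i) + b * Real.log (1 - y + y * l i)) ≤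
      ∑ i, Real.log (1 - (a * x + b * y) + (a * x + b * y) * l i) := by
    refine Finset.sum_le_sum fun i _ => ?_
    have h := strictConcaveOn_log_Ioi.concaveOn.2 (hpos x hx i) (hpos y hy i) ha hb hab
    simp only [smul_eq_mul] at h
    convert h using 2
    linear_combination (-1 : ℝ) * hab
  rw [Finset.sum_add_distrib, ← Finset.mul_sum, ← Finset.mul_sum] at key
  have : Real.log V.det = a * Real.log V.det + b * Real.log V.det := by
    rw [← add_mul, hab, one_mul]
  linarith

/-- Summing log l ≤ l - 1 over the generalized eigenvalues gives the tangent inequality of the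
concave function `log det` at V. -/
theorem log_det_sub_le_trace (hV : V.PosDef) (hB : B.PosDef) :
    Real.log B.det - Real.log V.det ≤ (V⁻¹ * B).trace - Fintype.card n := by
  obtain ⟨l, hl, hdet, htr⟩ := exists_relative_eigenvalues hV hB.posSemidef
  have h := hdet 0 1
  simp only [zero_smul, one_smul, zero_add, one_mul] at h
  have hprod : 0 < ∏ i, l i := by
    have := hB.det_pos
    rw [h] at this
    exact pos_of_mul_pos_right this hV.det_pos.le
  have hne : ∀ i ∈ Finset.univ, l i ≠ 0 := Finset.prod_ne_zero_iff.1 hprod.ne'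
  rw [h, Real.log_mul hV.det_pos.ne' hprod.ne', Real.log_prod hne, htr]
  have : ∑ i, Real.log (l i) ≤ ∑ i, (l i - 1) := Finset.sum_le_sum fun i hi =>
    Real.log_le_sub_one_of_pos (lt_of_le_of_ne (hl i) (hne i hi).symm)
  simp only [Finset.sum_sub_distrib, Finset.sum_const, Finset.card_univ, nsmul_eq_mul,
    mul_one] at this
  linarith

theorem one_add_sum_le_prod_one_add {ι : Type*} (s : Finset ι) (f : ι → ℝ) (hf : ∀ i, 0 ≤ f i) :
    1 + ∑ i ∈ s, f i ≤ ∏ i ∈ s, (1 + f i) := by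
  classical
  induction s using Finset.induction_on with
  | empty => simp
  | insert i s hi ih =>
    rw [Finset.sum_insert hi, Finset.prod_insert hi]
    have h1 := mul_le_mul_of_nonneg_left ih (add_nonneg zero_le_one (hf i))
    have h2 := mul_nonneg (hf i) (Finset.sum_nonneg fun j (_ : j ∈ s) => hf j)
    linarith

/-- The progress of a step of the Frank-Wolfe method for `log det` with the best step size. -/
theorem exists_step_progress [Nonempty n] (hV : V.PosDef) (hB : B.PosSemidef) {δ : ℝ}
    (hδ : 0 ≤ δ) (htrace : Fintype.card n + δ ≤ (V⁻¹ * B).trace) :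
    ∃ α ∈ Set.Ico (0 : ℝ) 1,
      δ ^ 2 / ((δ + Fintype.card n) * (δ + 2 * Fintype.card n)) ≤
        Real.log ((1 - α) • V + α • B).det - Real.log V.det := by
  obtain ⟨l, hl, hdet, htr⟩ := exists_relative_eigenvalues hV hB
  set k : ℝ := ((Fintype.card n : ℕ) : ℝ) with hk
  have hk0 : 0 < k := by rw [hk]; exact_mod_cast Fintype.card_pos
  -- With τ = α / (1 - α) the gain is log ∏ (1 + τ l_i) - k log (1 + τ). This τ maximizes the lower
  -- bound log (1 + τ (k + δ)) - k τ.
  set τ : ℝ := δ / (k * (k + δ)) with hτ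
  have hτ0 : 0 ≤ τ := by positivity
  have hτ1 : 0 < 1 + τ := by positivity
  refine ⟨τ / (1 + τ), ⟨by positivity, (div_lt_one hτ1).2 (by linarith)⟩, ?_⟩
  have h1 : 1 - τ / (1 + τ) = (1 + τ)⁻¹ := by field_simp; ring
  have h2 : (1 - τ / (1 + τ)) • V + (τ / (1 + τ)) • B =
      (1 + τ)⁻¹ • ((1 : ℝ) • V + τ • B) := by
    rw [h1, smul_add, smul_smul, smul_smul, mul_one]
    congr 2
    field_simp
  have hp : 1 + δ / k ≤ ∏ i, (1 + τ * l i) := by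
    have h := one_add_sum_le_prod_one_add Finset.univ (fun i => τ * l i)
      fun i => mul_nonneg hτ0 (hl i)
    refine le_trans ?_ h
    rw [← Finset.mul_sum, ← htr]
    have h3 := mul_le_mul_of_nonneg_left htrace hτ0
    have h4 : τ * (k + δ) = δ / k := by rw [hτ]; field_simp
    linarith
  have hδk : 0 ≤ δ / k := by positivity
  have hprod : 0 < ∏ i, (1 + τ * l i) := by linarith
  rw [h2, Matrix.det_smul, hdet, Real.log_mul (by positivity) (mul_pos hV.det_pos hprod).ne',
    Real.log_mul hV.det_pos.ne' hprod.ne', inv_pow, Real.log_inv, Real.log_pow, ← hk]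
  have h5 : Real.log (1 + τ) ≤ τ := by
    have := Real.log_le_sub_one_of_pos hτ1
    linarith
  have h6 : k * Real.log (1 + τ) ≤ δ / (k + δ) := by
    have := mul_le_mul_of_nonneg_left h5 hk0.le
    have h : k * τ = δ / (k + δ) := by rw [hτ]; field_simp
    linarith
  have h7 : Real.log (1 + δ / k) ≤ Real.log (∏ i, (1 + τ * l i)) :=
    Real.log_le_log (by linarith) hp
  -- The bound log (1 + u) ≥ 2u / (u + 2) at u = δ / k; subtracting δ / (k + δ) leaves exactly the
  -- claimed fraction.
  have h8 := Real.le_log_one_add_of_nonneg hδk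
  have h9 : δ ^ 2 / ((δ + k) * (δ + 2 * k)) = 2 * (δ / k) / (δ / k + 2) - δ / (k + δ) := by
    have : 0 < δ + k := by linarith
    have : 0 < δ + 2 * k := by linarith
    field_simp
    ring
  rw [h9]
  linarith

end LogDet

/-! ### Golden-section search for a concave function. -/

section GoldenSection

open Real (goldenRatio)

theorem goldenRatio_inv_add : goldenRatio⁻¹ + (goldenRatio ^ 2)⁻¹ = 1 := by
  have h := Real.goldenRatio_pos
  have h2 := Real.goldenRatio_sq
  generalize goldenRatio = φ at *
  field_simp
  linarith

theorem goldenRatio_inv_lt_one : goldenRatio⁻¹ < 1 := inv_lt_one_of_one_lt₀ Real.one_lt_goldenRatio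

theorem goldenRatio_inv_sq : (goldenRatio ^ 2)⁻¹ = goldenRatio⁻¹ * goldenRatio⁻¹ := by
  rw [sq, mul_inv]

/-- The geometry of the variables of the golden-section search. -/
structure GoldenState.Valid (s : GoldenState) : Prop where
  a_nonneg : 0 ≤ s.a
  b_le_one : s.b ≤ 1
  h_pos : 0 < s.h
  b_eq : s.b = s.a + s.h
  c_eq : s.c = s.a + s.h * (goldenRatio ^ 2)⁻¹
  d_eq : s.d = s.a + s.h * goldenRatio⁻¹

theorem GoldenState.Valid.init : goldenInit.Valid where
  a_nonneg := le_rfl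
  b_le_one := le_rfl
  h_pos := one_pos
  b_eq := by simp [goldenInit]
  c_eq := by simp [goldenInit]
  d_eq := by simp [goldenInit]

namespace GoldenState.Valid

variable {s : GoldenState}

theorem a_lt_c (hs : s.Valid) : s.a < s.c := by
  have h := mul_pos hs.h_pos (inv_pos.2 (pow_pos Real.goldenRatio_pos 2))
  linarith [hs.c_eq]

theorem c_lt_d (hs : s.Valid) : s.c < s.d := by
  rw [hs.c_eq, hs.d_eq, goldenRatio_inv_sq]
  have h := mul_lt_mul_of_pos_left goldenRatio_inv_lt_one (inv_pos.2 Real.goldenRatio_pos)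
  have := mul_lt_mul_of_pos_left h hs.h_pos
  linarith

theorem d_lt_b (hs : s.Valid) : s.d < s.b := by
  rw [hs.d_eq, hs.b_eq]
  have := mul_lt_mul_of_pos_left goldenRatio_inv_lt_one hs.h_pos
  linarith

theorem step (hs : s.Valid) (f : ℝ → ℝ) : (goldenStep f s).Valid := by
  have hac := hs.a_lt_c
  have hdb := hs.d_lt_b
  have ha := hs.a_nonneg
  have hb := hs.b_le_one
  have hp : 0 < s.h * goldenRatio⁻¹ := mul_pos hs.h_pos (inv_pos.2 Real.goldenRatio_pos)
  have hb' := hs.b_eq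
  have hc' := hs.c_eq
  have hd' := hs.d_eq
  have e1 := goldenRatio_inv_add
  have e2 := goldenRatio_inv_sq
  have e3 : goldenRatio⁻¹ + goldenRatio⁻¹ * goldenRatio⁻¹ = 1 := by rw [← e2, e1]
  rw [e2] at hc'
  unfold goldenStep
  split_ifs
  · refine ⟨ha, by simp only; linarith, hp, hd', rfl, ?_⟩
    simp only
    rw [hc']
    ring
  · refine ⟨by simp only; linarith, hb, hp, ?_, ?_, rfl⟩
    · simp only
      rw [hb', hc']
      linear_combination (-s.h) * e3
    · simp only
      rw [hd', hc', e2]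
      linear_combination (-s.h * goldenRatio⁻¹) * e3

theorem iterate (f : ℝ → ℝ) (n : ℕ) : ((goldenStep f)^[n] goldenInit).Valid := by
  induction n with
  | zero => exact init
  | succ n ih => rw [Function.iterate_succ_apply']; exact ih.step f

end GoldenState.Valid

theorem goldenStep_h (f : ℝ → ℝ) (s : GoldenState) :
    (goldenStep f s).h = s.h * goldenRatio⁻¹ := by
  unfold goldenStep
  split_ifs <;> rfl

theorem iterate_goldenStep_h (f : ℝ → ℝ) (n : ℕ) :
    ((goldenStep f)^[n] goldenInit).h = goldenRatio⁻¹ ^ n := by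
  induction n with
  | zero => rfl
  | succ n ih => rw [Function.iterate_succ_apply', goldenStep_h, ih, pow_succ]

theorem goldenPasses_spec (f : ℝ → ℝ) {tol : ℝ} (htol : 0 < tol) :
    ((goldenStep f)^[goldenPasses f tol] goldenInit).h < tol := by
  have habs : ∀ n, |((goldenStep f)^[n] goldenInit).a - ((goldenStep f)^[n] goldenInit).b| =
      ((goldenStep f)^[n] goldenInit).h := fun n => by
    have h := GoldenState.Valid.iterate f n
    rw [h.b_eq, sub_add_cancel_left, abs_neg, abs_of_pos h.h_pos]
  have hne : {n : ℕ | |((goldenStep f)^[n] goldenInit).a -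
      ((goldenStep f)^[n] goldenInit).b| < tol}.Nonempty := by
    obtain ⟨n, hn⟩ := exists_pow_lt_of_lt_one htol goldenRatio_inv_lt_one
    exact ⟨n, by rw [Set.mem_ofPred_eq, habs, iterate_goldenStep_h]; exact hn⟩
  have h := Nat.sInf_mem hne
  rw [Set.mem_ofPred_eq, habs] at h
  exact h

/-- Every interval of the search lies in [0, 1] and has positive length, so its midpoint is
interior, whatever the function and the tolerance. Thus no step reaches 1, where V could become
singular. -/
theorem goldenSearch_mem_Ioo (f : ℝ → ℝ) (tol : ℝ) : goldenSearch f tol ∈ Set.Ioo (0 : ℝ) 1 := by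
  have h := GoldenState.Valid.iterate f (goldenPasses f tol)
  have h1 := h.a_nonneg
  have h2 := h.b_le_one
  have h3 := h.h_pos
  have h4 := h.b_eq
  constructor <;> simp only [goldenSearch] <;> linarith

theorem min_le_of_concaveOn {f : ℝ → ℝ} {s : Set ℝ} (hf : ConcaveOn ℝ s f) {u v w : ℝ}
    (hu : u ∈ s) (hw : w ∈ s) (huv : u ≤ v) (hvw : v ≤ w) : min (f u) (f w) ≤ f v :=
  hf.min_le_of_mem_Icc hu hw ⟨huv, hvw⟩

/-- The search keeps, up to the value of `f`, any given point of `[0, 1)` in its interval. -/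
theorem exists_ge_goldenStep {f : ℝ → ℝ} (hf : ConcaveOn ℝ (Set.Ico (0 : ℝ) 1) f)
    {s : GoldenState} (hs : s.Valid) {z : ℝ} (hz : z ∈ Set.Icc s.a s.b) (hz1 : z < 1) :
    ∃ w ∈ Set.Icc (goldenStep f s).a (goldenStep f s).b, w < 1 ∧ f z ≤ f w := by
  have hac := hs.a_lt_c
  have hcd := hs.c_lt_d
  have hdb := hs.d_lt_b
  have ha := hs.a_nonneg
  have hb := hs.b_le_one
  have hzm : z ∈ Set.Ico (0 : ℝ) 1 := ⟨ha.trans hz.1, hz1⟩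
  have hcm : s.c ∈ Set.Ico (0 : ℝ) 1 := ⟨by linarith, by linarith⟩
  have hdm : s.d ∈ Set.Ico (0 : ℝ) 1 := ⟨by linarith, by linarith⟩
  unfold goldenStep
  split_ifs with hlt
  · rcases le_total z s.d with h | h
    · exact ⟨z, ⟨hz.1, h⟩, hz1, le_rfl⟩
    · refine ⟨s.d, ⟨by simp only; linarith, le_rfl⟩, hdm.2, ?_⟩
      rcases min_le_iff.1 (min_le_of_concaveOn hf hcm hzm hcd.le h) with h' | h'
      · exact absurd h' (not_le.2 hlt)
      · exact h'
  · rcases le_total s.c z with h | h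
    · exact ⟨z, ⟨h, hz.2⟩, hz1, le_rfl⟩
    · refine ⟨s.c, ⟨le_rfl, by simp only; linarith⟩, hcm.2, ?_⟩
      rcases min_le_iff.1 (min_le_of_concaveOn hf hzm hdm h hcd.le) with h' | h'
      · exact h'
      -- A tie also discards the left part. If z had a larger value there, c, as a convex
      -- combination with positive weight on z, would beat d by concavity.
      · have : f s.c = f s.d := le_antisymm (not_lt.1 hlt) h'
        rcases eq_or_lt_of_le h with rfl | hzc
        · exact le_rfl
        by_contra hcon
        have hcon := not_le.1 hcon
        obtain ⟨p, q, hp, hq, hpq, hc⟩ : ∃ p q : ℝ, 0 < p ∧ 0 ≤ q ∧ p + q = 1 ∧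
            p • z + q • s.d = s.c := by
          have hpos : 0 < s.d - z := by linarith
          refine ⟨(s.d - s.c) / (s.d - z), (s.c - z) / (s.d - z), div_pos (by linarith) hpos,
            div_nonneg (by linarith) hpos.le, by field_simp; ring, ?_⟩
          simp only [smul_eq_mul]
          field_simp
          ring
        have hcc := hf.2 hzm hdm hp.le hq hpq
        rw [hc] at hcc
        simp only [smul_eq_mul] at hcc
        have h1 := mul_lt_mul_of_pos_left hcon hp
        rw [← this] at hcc
        have h2 : p * f s.c + q * f s.c = f s.c := by rw [← add_mul, hpq, one_mul]
        linarith

/-- The surviving point z need not be y, but it lies in the final interval, whose length is below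
the tolerance. Closeness to an actual maximizer is neither needed nor claimed. -/
theorem exists_ge_near_goldenSearch {f : ℝ → ℝ} (hf : ConcaveOn ℝ (Set.Ico (0 : ℝ) 1) f)
    {tol : ℝ} (htol : 0 < tol) {y : ℝ} (hy : y ∈ Set.Ico (0 : ℝ) 1) :
    ∃ z ∈ Set.Ico (0 : ℝ) 1, f y ≤ f z ∧ |goldenSearch f tol - z| < tol := by
  have key : ∀ n, ∃ z ∈ Set.Icc ((goldenStep f)^[n] goldenInit).a
      ((goldenStep f)^[n] goldenInit).b, z < 1 ∧ f y ≤ f z := by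
    intro n
    induction n with
    | zero => exact ⟨y, ⟨hy.1, hy.2.le⟩, hy.2, le_rfl⟩
    | succ n ih =>
      obtain ⟨z, hz, hz1, hyz⟩ := ih
      obtain ⟨w, hw, hw1, hzw⟩ :=
        exists_ge_goldenStep hf (GoldenState.Valid.iterate f n) hz hz1
      rw [Function.iterate_succ_apply']
      exact ⟨w, hw, hw1, hyz.trans hzw⟩
  obtain ⟨z, hz, hz1, hyz⟩ := key (goldenPasses f tol)
  have hv := GoldenState.Valid.iterate f (goldenPasses f tol)
  refine ⟨z, ⟨hv.a_nonneg.trans hz.1, hz1⟩, hyz, ?_⟩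
  have h1 := goldenPasses_spec f htol
  have h2 := hv.b_eq
  have h3 := hv.h_pos
  have h4 := hz.1
  have h5 := hz.2
  simp only [goldenSearch]
  rw [abs_lt]
  constructor <;> linarith

end GoldenSection

/-! ### Correctness of the low-rank updates. -/

theorem sqrt_smul_mul_transpose {d : ℕ} {r : Type} [Fintype r]
    (A : Matrix (Fin d) r ℝ) {α : ℝ}
    (h0 : 0 ≤ α) :
    (Real.sqrt α • A) * (Real.sqrt α • A)ᵀ = α • (A * Aᵀ) := by
  rw [Matrix.transpose_smul, Matrix.smul_mul, Matrix.mul_smul, smul_smul, Real.mul_self_sqrt h0]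

section Update

variable {d : ℕ} {r : Type} [Fintype r] [DecidableEq r] {V : Matrix (Fin d) (Fin d) ℝ}

theorem posSemidef_mul_transpose {m k : Type*} [Fintype m] [Fintype k] (A : Matrix m k ℝ) :
    (A * Aᵀ).PosSemidef := by
  simpa using Matrix.posSemidef_self_mul_conjTranspose A

/-- Factor out (1 - α) V and exchange the two factors by det (1 + X Y) = det (1 + Y X), which
replaces the d × d determinant by an r × r one. -/
theorem det_segment_eq (hV : V.PosDef) (A : Matrix (Fin d) r ℝ) {α : ℝ} (h0 : 0 ≤ α)
    (h1 : α < 1) :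
    ((1 - α) • V + α • (A * Aᵀ)).det = (1 - α) ^ d * V.det *
      (1 + (Real.sqrt α • A)ᵀ * ((1 - α)⁻¹ • V⁻¹) * (Real.sqrt α • A)).det := by
  have h1' : (1 - α) ≠ 0 := (sub_pos.2 h1).ne'
  rw [Matrix.mul_assoc, Matrix.det_one_add_mul_comm, Matrix.mul_assoc,
    sqrt_smul_mul_transpose A h0]
  have h2 : (1 - α) ^ d * V.det = ((1 - α) • V).det := by rw [Matrix.det_smul, Fintype.card_fin]
  rw [h2, ← Matrix.det_mul, Matrix.mul_add, Matrix.mul_one, Matrix.smul_mul, Matrix.smul_mul,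
    Matrix.mul_smul, smul_smul, mul_inv_cancel₀ h1', one_smul, Matrix.mul_smul, Matrix.mul_smul,
    ← Matrix.mul_assoc, Matrix.mul_nonsing_inv _ hV.det_pos.ne'.isUnit, Matrix.one_mul]

theorem updateLogDet_eq (hV : V.PosDef) (A : Matrix (Fin d) r ℝ) {α : ℝ} (h0 : 0 ≤ α)
    (h1 : α < 1) :
    updateLogDet V⁻¹ A α = Real.log ((1 - α) • V + α • (A * Aᵀ)).det - Real.log V.det := by
  have hpos := (segment_posDef hV (posSemidef_mul_transpose A) h0 h1).det_pos
  rw [det_segment_eq hV A h0 h1] at hpos ⊢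
  have h2 : 0 < (1 - α) ^ d := pow_pos (sub_pos.2 h1) d
  have h3 := right_ne_zero_of_mul hpos.ne'
  rw [Real.log_mul (mul_pos h2 hV.det_pos).ne' h3, Real.log_mul h2.ne' hV.det_pos.ne',
    Real.log_pow]
  simp only [updateLogDet]
  ring

theorem updateInverse_eq (hV : V.PosDef) (A : Matrix (Fin d) r ℝ) {α : ℝ} (h0 : 0 ≤ α)
    (h1 : α < 1) :
    updateInverse V⁻¹ A α = ((1 - α) • V + α • (A * Aᵀ))⁻¹ := by
  have hpos := (segment_posDef hV (posSemidef_mul_transpose A) h0 h1).det_pos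
  rw [det_segment_eq hV A h0 h1] at hpos
  have h1' : 0 < 1 - α := sub_pos.2 h1
  have hinv : ((1 - α) • V)⁻¹ = (1 - α)⁻¹ • V⁻¹ := by
    refine Matrix.inv_eq_right_inv ?_
    rw [Matrix.smul_mul, Matrix.mul_smul, smul_smul, mul_inv_cancel₀ h1'.ne', one_smul,
      Matrix.mul_nonsing_inv _ hV.det_pos.ne'.isUnit]
  -- The Woodbury identity. Its inner matrix is invertible because its determinant is a factor of
  -- the positive determinant in `hpos`.
  have hW := Matrix.add_mul_mul_inv_eq_sub ((1 - α) • V) (Real.sqrt α • A) 1 (Real.sqrt α • A)ᵀ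
    (hV.smul h1').isUnit isUnit_one
    ((Matrix.isUnit_iff_isUnit_det _).2 (by
      rw [hinv, inv_one]
      exact (right_ne_zero_of_mul hpos.ne').isUnit))
  rw [Matrix.mul_one, sqrt_smul_mul_transpose A h0, hinv, inv_one] at hW
  rw [hW]
  rfl

end Update

/-! ### Design matrices on the simplex. -/

section Design

variable {N d K : ℕ} (x : Fin N → Fin d → ℝ)

theorem designMatrix_posSemidef {π : KSubset N K → ℝ} (hπ : ∀ S, 0 ≤ π S) :
    (designMatrix x π).PosSemidef :=
  Matrix.posSemidef_sum _ fun S _ => (posSemidef_mul_transpose _).smul (hπ S)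

theorem designMatrix_segment (π : KSubset N K → ℝ) (S : KSubset N K) (α : ℝ) :
    designMatrix x ((1 - α) • π + α • Pi.single S 1) =
      (1 - α) • designMatrix x π + α • (featMatrix x S.1 * (featMatrix x S.1)ᵀ) := by
  simp only [designMatrix, Pi.add_apply, Pi.smul_apply, smul_eq_mul, add_smul,
    Finset.sum_add_distrib, Finset.smul_sum, smul_smul]
  congr 1
  rw [Finset.sum_eq_single S]
  · simp
  · intro b _ hb
    simp [hb]
  · simp

theorem segment_mem_stdSimplex {π : KSubset N K → ℝ} (hπ : π ∈ stdSimplex ℝ (KSubset N K))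
    (S : KSubset N K) {α : ℝ} (h0 : 0 ≤ α) (h1 : α ≤ 1) :
    (1 - α) • π + α • Pi.single S 1 ∈ stdSimplex ℝ (KSubset N K) :=
  convex_stdSimplex ℝ _ hπ (single_mem_stdSimplex ℝ S) (sub_nonneg.2 h1) h0 (by ring)

theorem dist_segment_le {π : KSubset N K → ℝ} (hπ : π ∈ stdSimplex ℝ (KSubset N K))
    (S : KSubset N K) (α β : ℝ) :
    dist ((1 - α) • π + α • Pi.single S 1) ((1 - β) • π + β • Pi.single S 1) ≤ |α - β| := by
  refine (dist_pi_le_iff (abs_nonneg _)).2 fun i => ?_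
  have h1 : 0 ≤ π i := hπ.1 i
  have h2 : π i ≤ 1 := hπ.2 ▸ Finset.single_le_sum (fun j _ => hπ.1 j) (Finset.mem_univ i)
  obtain ⟨e, he0, he1, he⟩ : ∃ e : ℝ, 0 ≤ e ∧ e ≤ 1 ∧
      (Pi.single S 1 : KSubset N K → ℝ) i = e := by
    by_cases h : i = S
    · subst h; exact ⟨1, zero_le_one, le_rfl, by simp⟩
    · exact ⟨0, le_rfl, zero_le_one, by simp [h]⟩
  rw [Real.dist_eq]
  simp only [Pi.add_apply, Pi.smul_apply, smul_eq_mul, he]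
  have : (1 - α) * π i + α * e - ((1 - β) * π i + β * e) = (α - β) * (e - π i) := by ring
  rw [this, abs_mul]
  exact mul_le_of_le_one_right (abs_nonneg _) (abs_le.2 ⟨by linarith, by linarith⟩)

theorem partialGrad_eq_trace (W : Matrix (Fin d) (Fin d) ℝ) (S : Finset (Fin N)) :
    partialGrad x W S = (W * (featMatrix x S * (featMatrix x S)ᵀ)).trace := by
  rw [← Matrix.mul_assoc, Matrix.trace_mul_comm]
  simp only [partialGrad, Matrix.trace, Matrix.diag]
  refine Finset.sum_congr rfl fun p _ => ?_
  simp only [Matrix.mul_apply, dotProduct, Matrix.mulVec, Matrix.transpose_apply, featMatrix,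
    Matrix.of_apply]

theorem trace_mul_designMatrix (W : Matrix (Fin d) (Fin d) ℝ) (π : KSubset N K → ℝ) :
    (W * designMatrix x π).trace = ∑ S : KSubset N K, π S * partialGrad x W S.1 := by
  simp only [designMatrix, Matrix.mul_sum, Matrix.trace_sum, Matrix.mul_smul, Matrix.trace_smul,
    smul_eq_mul, partialGrad_eq_trace]

theorem continuous_designMatrix_det :
    Continuous fun π : KSubset N K → ℝ => (designMatrix x π).det := by
  refine Continuous.matrix_det ?_
  unfold designMatrix
  fun_prop

theorem designMatrix_posDef_of_rank {π : KSubset N K → ℝ} (hπ : ∀ S, 0 ≤ π S)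
    (hV : (designMatrix x π).rank = d) : (designMatrix x π).PosDef := by
  have hps := designMatrix_posSemidef x hπ
  rw [hps.posDef_iff_isUnit, ← Matrix.mulVec_surjective_iff_isUnit]
  have : LinearMap.range (designMatrix x π).mulVecLin = ⊤ :=
    Submodule.eq_top_of_finrank_eq (by simpa [Matrix.rank] using hV)
  exact LinearMap.range_eq_top.1 this

theorem exists_isDOptimal {π₀ : KSubset N K → ℝ} (hπ₀ : π₀ ∈ stdSimplex ℝ (KSubset N K))
    (hV : (designMatrix x π₀).PosDef) : ∃ πs : KSubset N K → ℝ, IsDOptimal x πs := by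
  obtain ⟨πs, hs, hmax⟩ := (isCompact_stdSimplex ℝ (KSubset N K)).exists_isMaxOn ⟨π₀, hπ₀⟩
    (continuous_designMatrix_det x).continuousOn
  have hdet : 0 < (designMatrix x πs).det := hV.det_pos.trans_le (hmax hπ₀)
  exact ⟨πs, hs, (designMatrix_posSemidef x hs.1).posDef_iff_det_ne_zero.2 hdet.ne',
    fun π' hπ' hV' => Real.log_le_log hV'.det_pos (hmax hπ')⟩

/-- The objective is uniformly continuous where the determinant is bounded away from zero. -/
theorem exists_objective_modulus (K : ℕ) {c η : ℝ} (hc : 0 < c) (hη : 0 < η) :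
    ∃ θ : ℝ, 0 < θ ∧ ∀ π ∈ stdSimplex ℝ (KSubset N K), ∀ π' ∈ stdSimplex ℝ (KSubset N K),
      dist π π' < θ → c ≤ (designMatrix x π).det → objective x π - η ≤ objective x π' := by
  have huc := (isCompact_stdSimplex ℝ (KSubset N K)).uniformContinuousOn_of_continuous
    (continuous_designMatrix_det x).continuousOn
  have he : Real.exp (-η) < 1 := by
    rw [← Real.exp_zero]
    exact Real.exp_lt_exp.2 (by linarith)
  -- With this modulus the determinant drops at most to a fraction exp (-η) of its value once that
  -- value is at least c. Only the first point needs the lower bound.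
  obtain ⟨θ, hθ, h⟩ := Metric.uniformContinuousOn_iff.1 huc (c * (1 - Real.exp (-η)))
    (mul_pos hc (sub_pos.2 he))
  refine ⟨θ, hθ, fun π hπ π' hπ' hd hcπ => ?_⟩
  have h1 := h π hπ π' hπ' hd
  rw [Real.dist_eq] at h1
  have h2 := (abs_lt.1 h1).2
  have h3 := mul_le_mul_of_nonneg_right hcπ (sub_pos.2 he).le
  have h4 : (designMatrix x π).det * Real.exp (-η) ≤ (designMatrix x π').det := by linarith
  have hdet : 0 < (designMatrix x π).det := hc.trans_le hcπ
  have h5 := Real.log_le_log (mul_pos hdet (Real.exp_pos _)) h4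
  rw [Real.log_mul hdet.ne' (Real.exp_pos _).ne', Real.log_exp] at h5
  exact h5

end Design

/-! ### Deterministic analysis of a run. -/

section Run

variable {N d K : ℕ} {x : Fin N → Fin d → ℝ}

/-- The invariant of the algorithm: the iterate is a design of full rank whose inverse design
matrix is the maintained matrix. -/
structure State.Valid (x : Fin N → Fin d → ℝ) (s : State N d K) : Prop where
  mem : s.iter ∈ stdSimplex ℝ (KSubset N K)
  posDef : (designMatrix x s.iter).PosDef
  vinv_eq : s.Vinv = (designMatrix x s.iter)⁻¹

theorem State.Valid.segment {s : State N d K} (hs : s.Valid x) (S : KSubset N K) {α : ℝ}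
    (h0 : 0 ≤ α) (h1 : α < 1) :
    (designMatrix x ((1 - α) • s.iter + α • Pi.single S 1)).PosDef := by
  rw [designMatrix_segment]
  exact segment_posDef hs.posDef (posSemidef_mul_transpose _) h0 h1

theorem State.Valid.step {s : State N d K} (hs : s.Valid x) (tol : ℝ) (S : KSubset N K) :
    (step x tol s S).Valid x := by
  have hα := goldenSearch_mem_Ioo (updateLogDet s.Vinv (featMatrix x S.1)) tol
  refine ⟨segment_mem_stdSimplex hs.mem S hα.1.le hα.2.le, hs.segment S hα.1.le hα.2, ?_⟩
  simp only [DopeWolfe.step]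
  rw [designMatrix_segment, ← updateInverse_eq hs.posDef _ hα.1.le hα.2, ← hs.vinv_eq]

theorem stateAt_valid {π₀ : KSubset N K → ℝ} (hπ₀ : π₀ ∈ stdSimplex ℝ (KSubset N K))
    (hV : (designMatrix x π₀).PosDef) (tol : ℝ) (chosen : ℕ → KSubset N K) (t : ℕ) :
    (stateAt x π₀ 0 tol chosen t).Valid x := by
  induction t with
  | zero => exact ⟨hπ₀, hV, by simp [stateAt, initState]⟩
  | succ t ih => exact ih.step tol _

theorem updateLogDet_eq_objective_sub {s : State N d K} (hs : s.Valid x) (S : KSubset N K) {α : ℝ}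
    (h0 : 0 ≤ α) (h1 : α < 1) :
    updateLogDet s.Vinv (featMatrix x S.1) α =
      objective x ((1 - α) • s.iter + α • Pi.single S 1) - objective x s.iter := by
  rw [hs.vinv_eq, updateLogDet_eq hs.posDef _ h0 h1, objective, objective, designMatrix_segment]

theorem concaveOn_updateLogDet {s : State N d K} (hs : s.Valid x) (S : KSubset N K) :
    ConcaveOn ℝ (Set.Ico (0 : ℝ) 1) (updateLogDet s.Vinv (featMatrix x S.1)) := by
  have h := (concaveOn_log_det hs.posDef
    (posSemidef_mul_transpose (featMatrix x S.1))).add_const (-Real.log (designMatrix x s.iter).det)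
  refine h.congr fun α hα => ?_
  rw [hs.vinv_eq, updateLogDet_eq hs.posDef _ hα.1 hα.2]
  rfl

/-- The golden-section step is nearly as good as any other step. -/
theorem objective_segment_le_step {s : State N d K} (hs : s.Valid x) {c η θ tol : ℝ}
    (hθ : ∀ π ∈ stdSimplex ℝ (KSubset N K), ∀ π' ∈ stdSimplex ℝ (KSubset N K),
      dist π π' < θ → c ≤ (designMatrix x π).det → objective x π - η ≤ objective x π')
    (hc : c ≤ (designMatrix x s.iter).det) (htol : 0 < tol) (htolθ : tol ≤ θ)
    (S : KSubset N K) {α : ℝ} (hα : α ∈ Set.Ico (0 : ℝ) 1) :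
    objective x ((1 - α) • s.iter + α • Pi.single S 1) - η ≤ objective x (step x tol s S).iter := by
  -- A competitor worse than staying put is replaced by α = 0. The point z found by the search then
  -- has determinant at least that of the current iterate, so the modulus applies at z.
  wlog hge : objective x s.iter ≤ objective x ((1 - α) • s.iter + α • Pi.single S 1) generalizing α
  · have h := this (α := 0) ⟨le_rfl, one_pos⟩ (by simp)
    simp only [sub_zero, one_smul, zero_smul, add_zero] at h
    linarith [not_le.1 hge]
  obtain ⟨z, hz, hfz, hdist⟩ := exists_ge_near_goldenSearch (concaveOn_updateLogDet hs S) htol hα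
  rw [updateLogDet_eq_objective_sub hs S hα.1 hα.2,
    updateLogDet_eq_objective_sub hs S hz.1 hz.2, sub_le_sub_iff_right] at hfz
  have hm := goldenSearch_mem_Ioo (updateLogDet s.Vinv (featMatrix x S.1)) tol
  have hdet : (designMatrix x s.iter).det ≤
      (designMatrix x ((1 - z) • s.iter + z • Pi.single S 1)).det :=
    (Real.log_le_log_iff hs.posDef.det_pos (hs.segment S hz.1 hz.2).det_pos).1 (hge.trans hfz)
  have h := hθ _ (segment_mem_stdSimplex hs.mem S hz.1 hz.2.le) _
    (segment_mem_stdSimplex hs.mem S hm.1.le hm.2.le)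
    ((dist_segment_le hs.mem S z _).trans_lt (by rw [abs_sub_comm]; exact hdist.trans_le htolθ))
    (hc.trans hdet)
  have h' : objective x ((1 - z) • s.iter + z • Pi.single S 1) - η ≤
    objective x (step x tol s S).iter := h
  linarith

/-- The two conclusions support each other by induction: the lower bound on g keeps the determinant
where the modulus is valid, and comparison with α = 0 costs at most η in the next iteration. Using
the level g(π₀) - T η throughout makes the modulus independent of t and of the run. -/
theorem exists_tolerance {π₀ : KSubset N K → ℝ} (hπ₀ : π₀ ∈ stdSimplex ℝ (KSubset N K))
    (hV : (designMatrix x π₀).PosDef) {η : ℝ} (hη : 0 < η) (T : ℕ) :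
    ∃ tol₀ : ℝ, 0 < tol₀ ∧ ∀ tol : ℝ, 0 < tol → tol ≤ tol₀ → ∀ chosen : ℕ → KSubset N K,
      ∀ t ≤ T, objective x π₀ - t * η ≤ objective x (stateAt x π₀ 0 tol chosen t).iter ∧
        ∀ α ∈ Set.Ico (0 : ℝ) 1,
          objective x ((1 - α) • (stateAt x π₀ 0 tol chosen t).iter +
            α • Pi.single (chosen t) 1) - η ≤
            objective x (stateAt x π₀ 0 tol chosen (t + 1)).iter := by
  obtain ⟨θ, hθ0, hθ⟩ := exists_objective_modulus x K
    (Real.exp_pos (objective x π₀ - T * η)) hη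
  refine ⟨θ, hθ0, fun tol htol htolθ chosen t => ?_⟩
  have hv := stateAt_valid hπ₀ hV tol chosen
  have key : ∀ t ≤ T, objective x π₀ - t * η ≤ objective x (stateAt x π₀ 0 tol chosen t).iter →
      ∀ α ∈ Set.Ico (0 : ℝ) 1, objective x ((1 - α) • (stateAt x π₀ 0 tol chosen t).iter +
            α • Pi.single (chosen t) 1) - η ≤
            objective x (stateAt x π₀ 0 tol chosen (t + 1)).iter := by
    intro t ht h α hα
    refine objective_segment_le_step (hv t) hθ ?_ htol htolθ _ hα
    rw [← Real.le_log_iff_exp_le (hv t).posDef.det_pos]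
    have : (t : ℝ) * η ≤ T * η := mul_le_mul_of_nonneg_right (by exact_mod_cast ht) hη.le
    exact le_trans (by linarith) h
  induction t with
  | zero =>
    intro ht
    have h : objective x π₀ - ((0 : ℕ) : ℝ) * η ≤
      objective x (stateAt x π₀ 0 tol chosen 0).iter := by simp [stateAt, initState]
    exact ⟨h, key 0 ht h⟩
  | succ t ih =>
    intro ht
    have h1 := (ih (by omega)).1
    have h2 := (ih (by omega)).2 0 ⟨le_rfl, one_pos⟩
    simp only [sub_zero, one_smul, zero_smul, add_zero] at h2
    have h : objective x π₀ - ((t + 1 : ℕ) : ℝ) * η ≤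
        objective x (stateAt x π₀ 0 tol chosen (t + 1)).iter := by
      push_cast
      linarith
    exact ⟨h, key _ ht h⟩

/-- The average of G under `πs` is the trace of V⁻¹ V_{πs}, which the tangent inequality bounds
below by d plus the gap; not all subsets can fall below an average. -/
theorem exists_partialGrad_ge {π πs : KSubset N K → ℝ} (hπ : (designMatrix x π).PosDef)
    (hs : IsDOptimal x πs) :
    ∃ S : KSubset N K, d + (objective x πs - objective x π) ≤
      partialGrad x (designMatrix x π)⁻¹ S.1 := by
  by_contra hcon
  push Not at hcon
  have h := log_det_sub_le_trace hπ hs.posDef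
  rw [trace_mul_designMatrix, Fintype.card_fin] at h
  have hsum : ∑ S, πs S = 1 := hs.mem.2
  obtain ⟨S, -, hS⟩ : ∃ S ∈ Finset.univ, 0 < πs S := by
    refine Finset.exists_lt_of_sum_lt (s := Finset.univ) (f := fun _ => (0 : ℝ)) ?_
    simp [hsum]
  have hlt : ∑ S, πs S * partialGrad x (designMatrix x π)⁻¹ S.1 <
      ∑ S, πs S * (d + (objective x πs - objective x π)) :=
    Finset.sum_lt_sum (fun S _ => mul_le_mul_of_nonneg_left (hcon S).le (hs.mem.1 S))
      ⟨S, Finset.mem_univ _, mul_lt_mul_of_pos_left (hcon S) hS⟩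
  rw [← Finset.sum_mul, hsum, one_mul] at hlt
  simp only [objective] at hlt
  linarith

end Run

/-! ### Integrals of functions of a finite-valued random variable. -/

section FiniteValued

variable {Ω ι : Type*} [Fintype ι] {Y : Ω → ι}

theorem indicator_comp_eq_sum (B : ι → Set Ω) (F : ι → ℝ) :
    ({ω | ω ∈ B (Y ω)}.indicator fun ω => F (Y ω)) =
      fun ω => ∑ i, ({ω | Y ω = i} ∩ B i).indicator (fun _ => F i) ω := by
  funext ω
  rw [Finset.sum_eq_single (Y ω)]
  · by_cases h : ω ∈ B (Y ω)
    · rw [Set.indicator_of_mem (by exact h), Set.indicator_of_mem]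
      exact ⟨rfl, h⟩
    · rw [Set.indicator_of_notMem (by exact h), Set.indicator_of_notMem fun h' => h h'.2]
  · intro i _ hi
    exact Set.indicator_of_notMem (fun h' => hi h'.1.symm) _
  · simp

variable [MeasurableSpace Ω] (μ : Measure Ω) [IsFiniteMeasure μ]

theorem integrable_indicator_comp (hY : ∀ i, MeasurableSet {ω | Y ω = i}) {B : ι → Set Ω}
    (hB : ∀ i, MeasurableSet (B i)) (F : ι → ℝ) :
    Integrable ({ω | ω ∈ B (Y ω)}.indicator fun ω => F (Y ω)) μ := by
  rw [indicator_comp_eq_sum B F]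
  exact integrable_finsetSum _ fun i _ => (integrable_const _).indicator ((hY i).inter (hB i))

theorem integral_indicator_comp (hY : ∀ i, MeasurableSet {ω | Y ω = i}) {B : ι → Set Ω}
    (hB : ∀ i, MeasurableSet (B i)) (F : ι → ℝ) :
    ∫ ω, ({ω | ω ∈ B (Y ω)}.indicator fun ω => F (Y ω)) ω ∂μ =
      ∑ i, μ.real ({ω | Y ω = i} ∩ B i) * F i := by
  rw [indicator_comp_eq_sum B F, integral_finsetSum _ fun i _ =>
    (integrable_const _).indicator ((hY i).inter (hB i))]
  refine Finset.sum_congr rfl fun i _ => ?_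
  rw [integral_indicator_const _ ((hY i).inter (hB i)), smul_eq_mul]

theorem integrable_comp_of_finite (hY : ∀ i, MeasurableSet {ω | Y ω = i}) (F : ι → ℝ) :
    Integrable (fun ω => F (Y ω)) μ := by
  simpa using integrable_indicator_comp μ hY (B := fun _ => Set.univ) (fun _ => .univ) F

theorem integral_comp_of_finite (hY : ∀ i, MeasurableSet {ω | Y ω = i}) (F : ι → ℝ) :
    ∫ ω, F (Y ω) ∂μ = ∑ i, μ.real {ω | Y ω = i} * F i := by
  simpa using integral_indicator_comp μ hY (B := fun _ => Set.univ) (fun _ => .univ) F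

end FiniteValued

/-! ### The finite history and the conditional law of the sample. -/

section History

variable {N d K R : ℕ} {x : Fin N → Fin d → ℝ} {π₀ : KSubset N K → ℝ} {tol : ℝ} {Ω : Type*}
  {samples : ℕ → Ω → Finset (KSubset N K)}
  {chosen : ℕ → Ω → KSubset N K}

/-- What has been sampled and chosen before iteration `t`. -/
def history (samples : ℕ → Ω → Finset (KSubset N K)) (chosen : ℕ → Ω → KSubset N K) (t : ℕ)
    (ω : Ω) : Fin t → Finset (KSubset N K) × KSubset N K :=
  fun i => (samples i ω, chosen i ω)

theorem history_eq_iff {t : ℕ} {h : Fin t → Finset (KSubset N K) × KSubset N K} {ω : Ω} :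
    history samples chosen t ω = h ↔
      ∀ i : Fin t, samples i ω = (h i).1 ∧ chosen i ω = (h i).2 := by
  simp only [funext_iff, history, Prod.ext_iff]

theorem stateAt_congr {γ : ℝ} {s s' : ℕ → KSubset N K} {t : ℕ} (h : ∀ i < t, s i = s' i) :
    stateAt x π₀ γ tol s t = stateAt x π₀ γ tol s' t := by
  induction t with
  | zero => rfl
  | succ t ih =>
    simp only [stateAt]
    rw [ih fun i hi => h i (by omega), h t (by omega)]

theorem exists_stateAt_eq_comp_history [Nonempty (KSubset N K)] (x : Fin N → Fin d → ℝ)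
    (π₀ : KSubset N K → ℝ) (γ tol : ℝ) (samples : ℕ → Ω → Finset (KSubset N K))
    (chosen : ℕ → Ω → KSubset N K) (t : ℕ) :
    ∃ Φ : (Fin t → Finset (KSubset N K) × KSubset N K) → State N d K,
      ∀ ω, stateAt x π₀ γ tol (fun i => chosen i ω) t = Φ (history samples chosen t ω) := by
  classical
  refine ⟨fun h => stateAt x π₀ γ tol
    (fun i => if hi : i < t then (h ⟨i, hi⟩).2 else Classical.arbitrary _) t, fun ω => ?_⟩
  refine stateAt_congr fun i hi => ?_
  simp [hi, history]

variable [MeasurableSpace Ω] {μ : Measure Ω}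

theorem measurableSet_history (hrun : IsRun x R π₀ 0 tol μ samples chosen) (t : ℕ)
    (h : Fin t → Finset (KSubset N K) × KSubset N K) :
    MeasurableSet {ω | history samples chosen t ω = h} := by
  simp only [history_eq_iff, Set.ofPred_forall]
  exact MeasurableSet.iInter fun i =>
    (hrun.measurable_samples i _).inter (hrun.measurable_chosen i _)

theorem measurableSet_mem_samples (hrun : IsRun x R π₀ 0 tol μ samples chosen) (t : ℕ)
    (S : KSubset N K) : MeasurableSet {ω | S ∈ samples t ω} := by
  have : {ω | S ∈ samples t ω} = ⋃ 𝓡 ∈ {𝓡 : Finset (KSubset N K) | S ∈ 𝓡},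
      {ω | samples t ω = 𝓡} := by
    ext ω
    simp
  rw [this]
  exact .biUnion (Set.to_countable _) fun 𝓡 _ => hrun.measurable_samples t 𝓡

theorem card_KSubset (N K : ℕ) : Fintype.card (KSubset N K) = N.choose K := by
  rw [Fintype.card_finset_len, Fintype.card_fin]

theorem measureReal_history_inter (hrun : IsRun x R π₀ 0 tol μ samples chosen) (t : ℕ)
    [Nonempty (KSubset N K)]
    (h : Fin t → Finset (KSubset N K) × KSubset N K) {𝓡 : Finset (KSubset N K)}
    (h𝓡 : 𝓡.card = R) :
    μ.real ({ω | history samples chosen t ω = h} ∩ {ω | samples t ω = 𝓡}) =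
      μ.real {ω | history samples chosen t ω = h} / ((N.choose K).choose R : ℕ) := by
  classical
  have hset : {ω | history samples chosen t ω = h} = {ω | ∀ i < t,
      samples i ω = (fun i => if hi : i < t then (h ⟨i, hi⟩).1 else ∅) i ∧
      chosen i ω = (fun i => if hi : i < t then (h ⟨i, hi⟩).2 else Classical.arbitrary _) i} := by
    ext ω
    simp only [Set.mem_ofPred_eq, history_eq_iff]
    constructor
    · intro H i hi
      simpa [hi] using H ⟨i, hi⟩
    · intro H i
      simpa using H i i.2
  have hu := hrun.uniform t (fun i => if hi : i < t then (h ⟨i, hi⟩).1 else ∅)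
    (fun i => if hi : i < t then (h ⟨i, hi⟩).2 else Classical.arbitrary _) 𝓡 h𝓡
  rw [← hset] at hu
  rw [measureReal_def, hu, ENNReal.toReal_div, ENNReal.toReal_natCast, measureReal_def]

variable [IsFiniteMeasure μ]

/-- Any given subset is sampled with probability at least `R / C(N, K)`, whatever the past. -/
theorem le_measureReal_history_mem (hR : 1 ≤ R) (hRN : R ≤ N.choose K)
    (hrun : IsRun x R π₀ 0 tol μ samples chosen) (t : ℕ)
    (h : Fin t → Finset (KSubset N K) × KSubset N K) (S : KSubset N K) :
    (R : ℝ) / N.choose K * μ.real {ω | history samples chosen t ω = h} ≤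
      μ.real ({ω | history samples chosen t ω = h} ∩ {ω | S ∈ samples t ω}) := by
  classical
  have : Nonempty (KSubset N K) := ⟨S⟩
  obtain ⟨k, rfl⟩ : ∃ k, R = k + 1 := ⟨R - 1, by omega⟩
  obtain ⟨m, hm⟩ : ∃ m, N.choose K = m + 1 := ⟨N.choose K - 1, by omega⟩
  -- The collections of R = k + 1 subsets that contain S. There are C(m, k) of them among C(m + 1, k
  -- + 1), a fraction (k + 1) / (m + 1).
  set 𝒞 : Finset (Finset (KSubset N K)) :=
    (Finset.powersetCard k (Finset.univ.erase S)).image (insert S) with h𝒞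
  have hnot : ∀ 𝓐 ∈ Finset.powersetCard k (Finset.univ.erase S), S ∉ 𝓐 := fun 𝓐 h𝓐 hS =>
    Finset.notMem_erase S _ ((Finset.mem_powersetCard.1 h𝓐).1 hS)
  have hcard : 𝒞.card = m.choose k := by
    rw [h𝒞, Finset.card_image_of_injOn, Finset.card_powersetCard,
      Finset.card_erase_of_mem (Finset.mem_univ _), Finset.card_univ, card_KSubset, hm,
      Nat.add_sub_cancel]
    intro 𝓐 h𝓐 𝓑 h𝓑 hab
    rw [← Finset.erase_insert (hnot 𝓐 h𝓐), ← Finset.erase_insert (hnot 𝓑 h𝓑)]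
    exact congrArg (fun 𝓢 => Finset.erase 𝓢 S) hab
  have hmem : ∀ 𝓡 ∈ 𝒞, S ∈ 𝓡 ∧ 𝓡.card = k + 1 := fun 𝓡 h𝓡 => by
    obtain ⟨𝓐, h𝓐, rfl⟩ := Finset.mem_image.1 h𝓡
    exact ⟨Finset.mem_insert_self _ _, by
      rw [Finset.card_insert_of_notMem (hnot 𝓐 h𝓐), (Finset.mem_powersetCard.1 h𝓐).2]⟩
  have hsub : (⋃ 𝓡 ∈ 𝒞, ({ω | history samples chosen t ω = h} ∩ {ω | samples t ω = 𝓡})) ⊆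
      {ω | history samples chosen t ω = h} ∩ {ω | S ∈ samples t ω} := by
    intro ω hω
    simp only [Set.mem_iUnion] at hω
    obtain ⟨𝓡, h𝓡, h1, h2⟩ := hω
    refine ⟨h1, ?_⟩
    have h2 : samples t ω = 𝓡 := h2
    rw [Set.mem_ofPred_eq, h2]
    exact (hmem 𝓡 h𝓡).1
  refine le_trans (le_of_eq ?_) (measureReal_mono hsub)
  rw [measureReal_biUnion_finset]
  · rw [Finset.sum_congr rfl fun 𝓡 h𝓡 => measureReal_history_inter hrun t h (hmem 𝓡 h𝓡).2,
      Finset.sum_const, hcard, hm, nsmul_eq_mul]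
    have hc := Nat.add_one_mul_choose_eq m k
    have hpos : 0 < (m + 1).choose (k + 1) := Nat.choose_pos (by omega)
    have hpos' : (0 : ℝ) < ((m + 1).choose (k + 1) : ℕ) := by exact_mod_cast hpos
    have hc' : ((m : ℝ) + 1) * (m.choose k : ℕ) = ((m + 1).choose (k + 1) : ℕ) * ((k : ℝ) + 1) := by
      exact_mod_cast hc
    push_cast
    field_simp
    linear_combination (-μ.real {ω | history samples chosen t ω = h}) * hc'
  · intro 𝓐 _ 𝓑 _ hab
    refine Set.disjoint_left.2 fun ω h1 h2 => hab ?_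
    exact (show samples t ω = 𝓐 from h1.2).symm.trans h2.2
  · exact fun 𝓡 _ => (measurableSet_history hrun t h).inter (hrun.measurable_samples t 𝓡)

/-- The target subset and the gain are functions of the history, so the sampling bound can be summed
over its finitely many values; this replaces conditional expectation. -/
theorem le_integral_indicator_mem_samples (hR : 1 ≤ R) (hRN : R ≤ N.choose K)
    (hrun : IsRun x R π₀ 0 tol μ samples chosen) (t : ℕ)
    {F : (Fin t → Finset (KSubset N K) × KSubset N K) → ℝ} (hF : ∀ h, 0 ≤ F h)
    (G : (Fin t → Finset (KSubset N K) × KSubset N K) → KSubset N K) :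
    (R : ℝ) / N.choose K * ∫ ω, F (history samples chosen t ω) ∂μ ≤
      ∫ ω, ({ω | G (history samples chosen t ω) ∈ samples t ω}.indicator
        fun ω => F (history samples chosen t ω)) ω ∂μ := by
  have h2 := integral_indicator_comp μ (measurableSet_history hrun t)
    (B := fun h => {ω | G h ∈ samples t ω}) (fun h => measurableSet_mem_samples hrun t _) F
  simp only [Set.mem_ofPred_eq] at h2
  rw [integral_comp_of_finite μ (measurableSet_history hrun t), h2, Finset.mul_sum]
  refine Finset.sum_le_sum fun h _ => ?_
  rw [← mul_assoc]
  exact mul_le_mul_of_nonneg_right (le_measureReal_history_mem hR hRN hrun t h _) (hF h)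

end History

/-! ### The scalar recursion for the expected gap. -/

section Recursion

theorem div_add_mono {a b u v : ℝ} (ha : 0 ≤ a) (hb : 0 < b) (hu : 0 ≤ u) (huv : u ≤ v) :
    u ^ 2 / (a * u + b) ≤ v ^ 2 / (a * v + b) := by
  have hv := hu.trans huv
  rw [div_le_div_iff₀ (by positivity) (by positivity)]
  have h1 : 0 ≤ v - u := sub_nonneg.2 huv
  have h2 : 0 ≤ a * u * v * (v - u) := by positivity
  have h3 : 0 ≤ b * (v + u) * (v - u) := by positivity
  linarith

/-- The potential argument: while it is larger than `ε`, a sequence with decrements at least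
`ρ e² / (a e + b)` increases `b / e - a log e` by at least `ρ` in each step. -/
theorem le_of_decrement {a b ρ δ₀ ε η : ℝ} (ha : 0 ≤ a) (hb : 0 < b) (hρ : 0 < ρ) (hε : 0 < ε)
    (hη : η ≤ ε / 2) (hη' : η ≤ ρ / 2 * ((ε / 2) ^ 2 / (a * (ε / 2) + b))) {T : ℕ} {e : ℕ → ℝ}
    (h0 : e 0 = δ₀) (he : ∀ t ≤ T, 0 ≤ e t)
    (hstep : ∀ t < T, e (t + 1) ≤ e t + η - 3 / 2 * ρ * (e t ^ 2 / (a * e t + b)))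
    (hT : a * max (Real.log (δ₀ / ε)) 0 + b * max (1 / ε - 1 / δ₀) 0 ≤ ρ * T) : e T ≤ ε := by
  have key : ∀ t ≤ T, ε < e t → e t ≤ δ₀ ∧
      a * Real.log (e t) - b / e t ≤ a * Real.log δ₀ - b / δ₀ - ρ * t := by
    intro t
    induction t with
    | zero => intro _ _; rw [h0]; simp
    | succ t ih =>
      intro ht hlt
      have hq0 : 0 ≤ e t ^ 2 / (a * e t + b) := by
        have := he t (by omega)
        positivity
      have hs := hstep t (by omega)
      -- One step increases the sequence by at most η ≤ ε / 2, so it cannot pass from below ε / 2 to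
      -- above ε.
      have hhalf : ε / 2 ≤ e t := by
        by_contra hcon
        have := mul_nonneg hρ.le hq0
        linarith [not_le.1 hcon]
      have hq := mul_le_mul_of_nonneg_left
        (div_add_mono ha hb (half_pos hε).le hhalf) (half_pos hρ).le
      have hs' : e (t + 1) ≤ e t - ρ * (e t ^ 2 / (a * e t + b)) := by linarith
      have hle : e (t + 1) ≤ e t := by
        have := mul_nonneg hρ.le hq0
        linarith
      obtain ⟨h1, h2⟩ := ih (by omega) (hlt.trans_le hle)
      refine ⟨hle.trans h1, ?_⟩
      have hy : 0 < e (t + 1) := hε.trans hlt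
      have hx : 0 < e t := hy.trans_le hle
      have hlog : Real.log (e (t + 1)) - Real.log (e t) ≤ e (t + 1) / e t - 1 := by
        rw [← Real.log_div hy.ne' hx.ne']
        exact Real.log_le_sub_one_of_pos (div_pos hy hx)
      have hinv : b / e t + b * (e t - e (t + 1)) / e t ^ 2 ≤ b / e (t + 1) := by
        have : b / e (t + 1) - b / e t - b * (e t - e (t + 1)) / e t ^ 2 =
            b * (e t - e (t + 1)) ^ 2 / (e t ^ 2 * e (t + 1)) := by
          field_simp
        have h : 0 ≤ b * (e t - e (t + 1)) ^ 2 / (e t ^ 2 * e (t + 1)) := by positivity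
        linarith
      -- The factor a / e + b / e² is the derivative of a log e - b / e and the reciprocal of the
      -- guaranteed decrement divided by ρ.
      have hdec : ρ ≤ (e t - e (t + 1)) * (a / e t + b / e t ^ 2) := by
        have h3 : ρ * (e t ^ 2 / (a * e t + b)) ≤ e t - e (t + 1) := by linarith
        have h4 := mul_le_mul_of_nonneg_right h3 (show 0 ≤ a / e t + b / e t ^ 2 by positivity)
        have h5 : ρ * (e t ^ 2 / (a * e t + b)) * (a / e t + b / e t ^ 2) = ρ := by
          have : 0 < a * e t + b := by positivity
          field_simp
        linarith
      have hlog' := mul_le_mul_of_nonneg_left hlog ha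
      have hexp : (e t - e (t + 1)) * (a / e t + b / e t ^ 2) =
          -(a * (e (t + 1) / e t - 1)) + b * (e t - e (t + 1)) / e t ^ 2 := by
        field_simp
        ring
      push_cast
      linarith
  by_contra hcon
  have hlt := not_le.1 hcon
  obtain ⟨h1, h2⟩ := key T le_rfl hlt
  have hδ : 0 < δ₀ := hε.trans (hlt.trans_le h1)
  have h3 : a * Real.log (δ₀ / ε) ≤ a * max (Real.log (δ₀ / ε)) 0 :=
    mul_le_mul_of_nonneg_left (le_max_left _ _) ha
  have h4 : b * (1 / ε - 1 / δ₀) ≤ b * max (1 / ε - 1 / δ₀) 0 :=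
    mul_le_mul_of_nonneg_left (le_max_left _ _) hb.le
  rw [Real.log_div hδ.ne' hε.ne'] at h3 hT
  have h5 : a * Real.log ε ≤ a * Real.log (e T) :=
    mul_le_mul_of_nonneg_left (Real.log_le_log hε hlt.le) ha
  have h6 : b / e T < b / ε := div_lt_div_of_pos_left hb hε hlt
  have h7 : b * (1 / ε - 1 / δ₀) = b / ε - b / δ₀ := by ring
  linarith

end Recursion

/-! ### Expected progress and the iteration count. -/

section Expectation

variable {N d K R : ℕ} {x : Fin N → Fin d → ℝ} {π₀ πs : KSubset N K → ℝ}

theorem iterationBound_le {δ₀ ε : ℝ} (hδ : 0 ≤ δ₀)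
    (hε : 0 < ε) :
    iterationBound N d K R δ₀ ε ≤
      (12 * (d : ℝ) ^ 2 + 5.3 * δ₀ * (δ₀ + d)) * max 1 ((N.choose K : ℝ) / R) * ε⁻¹ := by
  have hd : (0 : ℝ) ≤ d := d.cast_nonneg
  have h1 : max (Real.log (δ₀ / ε)) 0 ≤ δ₀ * ε⁻¹ :=
    max_le ((Real.log_le_self (by positivity)).trans_eq (div_eq_mul_inv _ _)) (by positivity)
  have h2 : max (1 / ε - 1 / δ₀) 0 ≤ ε⁻¹ := by
    refine max_le ?_ (by positivity)
    have : 0 ≤ 1 / δ₀ := by positivity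
    rw [← one_div]
    linarith
  have h3 := mul_le_mul_of_nonneg_left h1 (show 0 ≤ 5.3 * (δ₀ + d) by positivity)
  have h4 := mul_le_mul_of_nonneg_left h2 (show 0 ≤ 12 * (d : ℝ) ^ 2 by positivity)
  calc iterationBound N d K R δ₀ ε
      ≤ ((N.choose K : ℝ) / R) * ((12 * (d : ℝ) ^ 2 + 5.3 * δ₀ * (δ₀ + d)) * ε⁻¹) :=
        mul_le_mul_of_nonneg_left (by linarith) (by positivity)
    _ ≤ max 1 ((N.choose K : ℝ) / R) * ((12 * (d : ℝ) ^ 2 + 5.3 * δ₀ * (δ₀ + d)) * ε⁻¹) :=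
        mul_le_mul_of_nonneg_right (le_max_right _ _) (by positivity)
    _ = _ := by ring

theorem integrable_objective [Nonempty (KSubset N K)] {tol : ℝ} {Ω : Type*} [MeasurableSpace Ω]
    {μ : Measure Ω} [IsFiniteMeasure μ] {samples : ℕ → Ω → Finset (KSubset N K)}
    {chosen : ℕ → Ω → KSubset N K} (hrun : IsRun x R π₀ 0 tol μ samples chosen) (t : ℕ) :
    Integrable (fun ω => objective x (stateAt x π₀ 0 tol (fun i => chosen i ω) t).iter) μ := by
  obtain ⟨Φ, hΦ⟩ := exists_stateAt_eq_comp_history x π₀ 0 tol samples chosen t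
  simp only [hΦ]
  exact integrable_comp_of_finite μ (measurableSet_history hrun t) fun h => objective x (Φ h).iter

/-- The expected progress of an iteration in which any step `α` would be at most `η` better. -/
theorem integral_objective_step (hR : 1 ≤ R) (hRN : R ≤ N.choose K) (hd : 0 < d)
    (hπ₀ : π₀ ∈ stdSimplex ℝ (KSubset N K)) (hV : (designMatrix x π₀).PosDef)
    (hs : IsDOptimal x πs) {tol η : ℝ} {Ω : Type*} [MeasurableSpace Ω]
    {μ : Measure Ω} [IsProbabilityMeasure μ] {samples : ℕ → Ω → Finset (KSubset N K)}
    {chosen : ℕ → Ω → KSubset N K} (hrun : IsRun x R π₀ 0 tol μ samples chosen) (t : ℕ)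
    (hstep : ∀ ω, ∀ α ∈ Set.Ico (0 : ℝ) 1,
      objective x ((1 - α) • (stateAt x π₀ 0 tol (fun i => chosen i ω) t).iter +
        α • Pi.single (chosen t ω) 1) - η ≤
        objective x (stateAt x π₀ 0 tol (fun i => chosen i ω) (t + 1)).iter)
    {a b : ℝ} (ha : 0 ≤ a) (hb : 0 < b)
    (hab : ∀ ω, ∀ δ : ℝ,
      δ = objective x πs - objective x (stateAt x π₀ 0 tol (fun i => chosen i ω) t).iter →
      3 / 2 * ((δ + d) * (δ + 2 * d)) ≤ a * δ + b) {e : ℝ}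
    (he : e = ∫ ω, (objective x πs -
      objective x (stateAt x π₀ 0 tol (fun i => chosen i ω) t).iter) ∂μ) :
    ∫ ω, (objective x πs -
      objective x (stateAt x π₀ 0 tol (fun i => chosen i ω) (t + 1)).iter) ∂μ ≤
      e + η - 3 / 2 * (R / N.choose K) * (e ^ 2 / (a * e + b)) := by
  have hne : Nonempty (KSubset N K) := by
    rw [← Fintype.card_pos_iff, card_KSubset]
    omega
  have hd0 : (0 : ℝ) < d := by exact_mod_cast hd
  have : Nonempty (Fin d) := ⟨⟨0, hd⟩⟩
  obtain ⟨Φ, hΦ⟩ := exists_stateAt_eq_comp_history x π₀ 0 tol samples chosen t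
  -- The target is needed for every value of the history, also for those that never occur, so an
  -- arbitrary subset is used when the design matrix is not positive definite.
  have hbest : ∀ π : KSubset N K → ℝ, ∃ S : KSubset N K, (designMatrix x π).PosDef →
      d + (objective x πs - objective x π) ≤ partialGrad x (designMatrix x π)⁻¹ S.1 := fun π => by
    by_cases h : (designMatrix x π).PosDef
    · obtain ⟨S, hS⟩ := exists_partialGrad_ge h hs
      exact ⟨S, fun _ => hS⟩
    · exact ⟨hne.some, fun h' => absurd h' h⟩
  choose G hG using hbest
  set δ : Ω → ℝ := fun ω =>
    objective x πs - objective x (stateAt x π₀ 0 tol (fun i => chosen i ω) t).iter with hδ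
  -- Truncation at 0 keeps the gain nonnegative at unrealized histories, where the gap has no sign;
  -- on actual runs it changes nothing.
  set p : ℝ → ℝ := fun u => max u 0 ^ 2 / ((max u 0 + d) * (max u 0 + 2 * d)) with hp
  have hp0 : ∀ u, 0 ≤ p u := fun u => by
    have : 0 ≤ max u 0 := le_max_right _ _
    positivity
  have hv := fun ω => stateAt_valid hπ₀ hV tol (fun i => chosen i ω) t
  have hδ0 : ∀ ω, 0 ≤ δ ω := fun ω => sub_nonneg.2 (hs.le _ (hv ω).mem (hv ω).posDef)
  have hδint : Integrable δ μ := (integrable_const _).sub (integrable_objective hrun t)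
  have he0 : 0 ≤ e := he ▸ integral_nonneg hδ0
  have hpδ : ∀ ω, δ ω = objective x πs - objective x (Φ (history samples chosen t ω)).iter :=
    fun ω => by rw [hδ]; simp only [hΦ]
  have hpint : Integrable (fun ω => p (δ ω)) μ := by
    simp only [hpδ]
    exact integrable_comp_of_finite μ (measurableSet_history hrun t)
      fun h => p (objective x πs - objective x (Φ h).iter)
  set A : Set Ω := {ω | G (Φ (history samples chosen t ω)).iter ∈ samples t ω} with hA
  have hindint : Integrable (A.indicator fun ω => p (δ ω)) μ := by
    simp only [hpδ]
    have h := integrable_indicator_comp μ (measurableSet_history hrun t)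
      (B := fun h => {ω | G (Φ h).iter ∈ samples t ω})
      (fun h => measurableSet_mem_samples hrun t _)
      fun h => p (objective x πs - objective x (Φ h).iter)
    exact h
  have hind : (R : ℝ) / N.choose K * ∫ ω, p (δ ω) ∂μ ≤
      ∫ ω, (A.indicator fun ω => p (δ ω)) ω ∂μ := by
    simp only [hpδ]
    exact le_integral_indicator_mem_samples hR hRN hrun t
      (F := fun h => p (objective x πs - objective x (Φ h).iter)) (fun h => hp0 _)
      fun h => G (Φ h).iter
  have hprog : ∀ᵐ ω ∂μ, objective x πs -
      objective x (stateAt x π₀ 0 tol (fun i => chosen i ω) (t + 1)).iter ≤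
      δ ω + η - (A.indicator fun ω => p (δ ω)) ω := by
    filter_upwards [hrun.argmax] with ω hω
    by_cases hωA : ω ∈ A
    · rw [Set.indicator_of_mem hωA]
      have hωA : G (Φ (history samples chosen t ω)).iter ∈ samples t ω := hωA
      rw [← hΦ] at hωA
      have h1 := (hω t).2 _ hωA
      rw [(hv ω).vinv_eq] at h1
      have h2 := (hG _ (hv ω).posDef).trans h1
      rw [partialGrad_eq_trace] at h2
      obtain ⟨α, hα, h3⟩ := exists_step_progress (hv ω).posDef
        (posSemidef_mul_transpose (featMatrix x (chosen t ω).1)) (hδ0 ω)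
        (by rw [Fintype.card_fin]; exact h2)
      rw [← designMatrix_segment, Fintype.card_fin] at h3
      have h4 := hstep ω α hα
      have h5 : p (δ ω) = δ ω ^ 2 / ((δ ω + d) * (δ ω + 2 * d)) := by
        rw [hp]
        simp only [max_eq_left (hδ0 ω)]
      rw [h5]
      simp only [objective, hδ] at h3 h4 ⊢
      linarith
    · rw [Set.indicator_of_notMem hωA]
      have h4 := hstep ω 0 ⟨le_rfl, one_pos⟩
      simp only [sub_zero, one_smul, zero_smul, add_zero] at h4
      simp only [hδ]
      linarith
  set κ : ℝ := e / (a * e + b) with hκ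
  have hden : 0 < a * e + b := by positivity
  -- Jensen's inequality by hand: 2κu - κ²(au + b) is the tangent at u = e of the convex function u²
  -- / (au + b), and lies below it because (u - κ(au + b))² ≥ 0.
  have htan : ∀ ω, 3 / 2 * (2 * κ * δ ω - κ ^ 2 * (a * δ ω + b)) ≤ p (δ ω) := fun ω => by
    have hu := hδ0 ω
    have hpe : p (δ ω) = δ ω ^ 2 / ((δ ω + d) * (δ ω + 2 * d)) := by
      rw [hp]
      simp only [max_eq_left hu]
    have hD : 0 < (δ ω + d) * (δ ω + 2 * d) := by positivity
    have hD' : 0 < a * δ ω + b := by positivity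
    have h1 : 2 * κ * δ ω - κ ^ 2 * (a * δ ω + b) ≤ δ ω ^ 2 / (a * δ ω + b) := by
      rw [le_div_iff₀ hD']
      have := sq_nonneg (δ ω - κ * (a * δ ω + b))
      linarith
    have h2 : 3 / 2 * (δ ω ^ 2 / (a * δ ω + b)) ≤ p (δ ω) := by
      rw [hpe, ← mul_div_assoc, div_le_div_iff₀ hD' hD]
      have := mul_le_mul_of_nonneg_left (hab ω (δ ω) rfl) (sq_nonneg (δ ω))
      linarith
    linarith
  have hmean : 3 / 2 * (e ^ 2 / (a * e + b)) ≤ ∫ ω, p (δ ω) ∂μ := by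
    have hlin₁ : Integrable (fun ω => a * δ ω + b) μ :=
      (hδint.const_mul _).add (integrable_const _)
    have hlin : Integrable (fun ω => 3 / 2 * (2 * κ * δ ω - κ ^ 2 * (a * δ ω + b))) μ :=
      ((hδint.const_mul _).sub (hlin₁.const_mul _)).const_mul _
    have h := integral_mono hlin hpint htan
    rw [integral_const_mul, integral_sub (hδint.const_mul _) (hlin₁.const_mul _),
      integral_const_mul,
      integral_const_mul, integral_add (hδint.const_mul _) (integrable_const _),
      integral_const_mul, integral_const, ← he] at h
    simp only [probReal_univ, one_smul] at h
    have h' : 2 * κ * e - κ ^ 2 * (a * e + b) = e ^ 2 / (a * e + b) := by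
      rw [hκ]
      field_simp
      ring
    rwa [h'] at h
  have hfin := integral_mono_ae ((integrable_const _).sub (integrable_objective hrun (t + 1)))
    ((hδint.add (integrable_const η)).sub hindint) hprog
  have hsplit : ∫ ω, (δ ω + η - (A.indicator fun ω => p (δ ω)) ω) ∂μ =
      e + η - ∫ ω, (A.indicator fun ω => p (δ ω)) ω ∂μ := by
    have hδη : Integrable (fun ω => δ ω + η) μ := hδint.add (integrable_const η)
    rw [integral_sub hδη hindint,
      integral_add hδint (integrable_const η), integral_const, ← he]
    simp
  have hfin' : ∫ ω, (objective x πs -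
      objective x (stateAt x π₀ 0 tol (fun i => chosen i ω) (t + 1)).iter) ∂μ ≤
      e + η - ∫ ω, (A.indicator fun ω => p (δ ω)) ω ∂μ := hsplit ▸ hfin
  have hρ := mul_le_mul_of_nonneg_left hmean (show (0 : ℝ) ≤ R / N.choose K by positivity)
  linarith

theorem exists_tolerance_expected_gap_le (hR : 1 ≤ R) (hRN : R ≤ N.choose K) (hd : 0 < d)
    (hπ₀ : π₀ ∈ stdSimplex ℝ (KSubset N K)) (hV : (designMatrix x π₀).PosDef)
    (hs : IsDOptimal x πs) {ε : ℝ} (hε : 0 < ε) {T : ℕ}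
    (hT : iterationBound N d K R (objective x πs - objective x π₀) ε ≤ T) :
    ∃ tol₀ : ℝ, 0 < tol₀ ∧ ∀ tol : ℝ, 0 < tol → tol ≤ tol₀ →
      ∀ (Ω : Type*) [MeasurableSpace Ω] (μ : Measure Ω) [IsProbabilityMeasure μ]
        (samples : ℕ → Ω → Finset (KSubset N K)) (chosen : ℕ → Ω → KSubset N K),
        IsRun x R π₀ 0 tol μ samples chosen →
        ∫ ω, (objective x πs -
          objective x (stateAt x π₀ 0 tol (fun i => chosen i ω) T).iter) ∂μ ≤ ε := by
  have hd0 : (0 : ℝ) < d := by exact_mod_cast hd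
  set δ₀ := objective x πs - objective x π₀ with hδ₀
  have hδ0 : 0 ≤ δ₀ := sub_nonneg.2 (hs.le _ hπ₀ hV)
  set a : ℝ := 5.3 * (δ₀ + d) with ha
  set b : ℝ := 12 * (d : ℝ) ^ 2 with hb
  have ha0 : 0 ≤ a := by positivity
  have hb0 : 0 < b := by positivity
  set ρ : ℝ := (R : ℝ) / N.choose K with hρ
  have hR0 : (0 : ℝ) < R := by exact_mod_cast hR
  have hM0 : (0 : ℝ) < N.choose K := by exact_mod_cast lt_of_lt_of_le hR hRN
  have hρ0 : 0 < ρ := div_pos hR0 hM0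
  -- The first two terms are the requirements of `le_of_decrement`; the third limits the total loss
  -- over T iterations to d / 2.
  set η : ℝ := min (min (ε / 2) (ρ / 2 * ((ε / 2) ^ 2 / (a * (ε / 2) + b))))
    (d / 2 / (T + 1)) with hη
  have hη0 : 0 < η := by
    refine lt_min (lt_min (by positivity) (by positivity)) (by positivity)
  have hηT : (T : ℝ) * η ≤ d / 2 := by
    have h1 : η ≤ d / 2 / (T + 1) := min_le_right _ _
    rw [le_div_iff₀ (by positivity)] at h1
    linarith
  have hne : Nonempty (KSubset N K) := by
    rw [← Fintype.card_pos_iff, card_KSubset]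
    omega
  obtain ⟨tol₀, htol₀, htol⟩ := exists_tolerance hπ₀ hV hη0 T
  refine ⟨tol₀, htol₀, fun tol h0 h1 Ω _ μ _ samples chosen hrun => ?_⟩
  have hv := fun ω t => stateAt_valid hπ₀ hV tol (fun i => chosen i ω) t
  refine le_of_decrement (e := fun t => ∫ ω, (objective x πs -
      objective x (stateAt x π₀ 0 tol (fun i => chosen i ω) t).iter) ∂μ) (δ₀ := δ₀) (η := η)
    ha0 hb0 hρ0 hε ((min_le_left _ _).trans (min_le_left _ _))
    ((min_le_left _ _).trans (min_le_right _ _)) ?_ ?_ ?_ ?_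
  · simp [stateAt, initState, hδ₀]
  · exact fun t _ => integral_nonneg fun ω => sub_nonneg.2 (hs.le _ (hv ω t).mem (hv ω t).posDef)
  · intro t ht
    refine integral_objective_step hR hRN hd hπ₀ hV hs hrun t
      (fun ω => (htol tol h0 h1 (fun i => chosen i ω) t ht.le).2) ha0 hb0 ?_ rfl
    intro ω δ hδ
    have hle := (htol tol h0 h1 (fun i => chosen i ω) t ht.le).1
    have hδn : 0 ≤ δ := hδ ▸ sub_nonneg.2 (hs.le _ (hv ω t).mem (hv ω t).posDef)
    have htT : (t : ℝ) * η ≤ T * η := mul_le_mul_of_nonneg_right (by exact_mod_cast ht.le) hη0.le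
    -- Hence (3/2)(δ + d)(δ + 2d) ≤ (1.5 δ₀ + 5.25 d) δ + 3 d², which explains the constant 5.3; the
    -- 12 has room to spare.
    have hδle : δ ≤ δ₀ + d / 2 := by linarith
    have h2 := mul_le_mul_of_nonneg_left hδle hδn
    have h3 := mul_nonneg hδn hδ0
    have h4 := mul_nonneg hδn hd0.le
    have h5 := sq_nonneg (d : ℝ)
    rw [ha, hb]
    linarith
  · have h2 : iterationBound N d K R δ₀ ε =
        ρ⁻¹ * (a * max (Real.log (δ₀ / ε)) 0 + b * max (1 / ε - 1 / δ₀) 0) := by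
      rw [hρ, inv_div]
      rfl
    rw [h2, inv_mul_le_iff₀ hρ0] at hT
    exact hT

end Expectation

end DopeWolfe

end

/-! ### The main theorem. -/

theorem corollary1 {N d K R : ℕ} (hR : 1 ≤ R) (hRN : R ≤ N.choose K)
    (x : Fin N → Fin d → ℝ) (π₀ : DopeWolfe.KSubset N K → ℝ)
    (hπ₀ : π₀ ∈ stdSimplex ℝ (DopeWolfe.KSubset N K))
    (hV : (DopeWolfe.designMatrix x π₀).rank = d) :
    (∃ πs : DopeWolfe.KSubset N K → ℝ, DopeWolfe.IsDOptimal x πs) ∧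
    ∀ πs : DopeWolfe.KSubset N K → ℝ, DopeWolfe.IsDOptimal x πs →
    ∀ δ₀ : ℝ, δ₀ = DopeWolfe.objective x πs - DopeWolfe.objective x π₀ →
    ∀ ε : ℝ, 0 < ε →
      DopeWolfe.iterationBound N d K R δ₀ ε ≤
        (12 * (d : ℝ) ^ 2 + 5.3 * δ₀ * (δ₀ + d)) * max 1 ((N.choose K : ℝ) / R) * ε⁻¹ ∧
      ∀ T : ℕ, DopeWolfe.iterationBound N d K R δ₀ ε ≤ T →
        ∃ tol₀ : ℝ, 0 < tol₀ ∧ ∀ tol : ℝ, 0 < tol → tol ≤ tol₀ →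
          ∀ (Ω : Type*) [MeasurableSpace Ω] (μ : Measure Ω) [IsProbabilityMeasure μ]
            (samples : ℕ → Ω → Finset (DopeWolfe.KSubset N K))
            (chosen : ℕ → Ω → DopeWolfe.KSubset N K),
            DopeWolfe.IsRun x R π₀ 0 tol μ samples chosen →
            (∀ᵐ ω ∂μ,
              (DopeWolfe.stateAt x π₀ 0 tol (fun i => chosen i ω) T).iter ∈
                stdSimplex ℝ (DopeWolfe.KSubset N K) ∧
              (DopeWolfe.designMatrix x
                (DopeWolfe.stateAt x π₀ 0 tol (fun i => chosen i ω) T).iter).PosDef) ∧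
            Integrable (fun ω => DopeWolfe.objective x
              (DopeWolfe.stateAt x π₀ 0 tol (fun i => chosen i ω) T).iter) μ ∧
            DopeWolfe.objective x πs - ∫ ω, DopeWolfe.objective x
              (DopeWolfe.stateAt x π₀ 0 tol (fun i => chosen i ω) T).iter ∂μ ≤ ε := by
  have hps := DopeWolfe.designMatrix_posDef_of_rank x hπ₀.1 hV
  have hne : Nonempty (DopeWolfe.KSubset N K) := by
    rw [← Fintype.card_pos_iff, DopeWolfe.card_KSubset]
    omega
  refine ⟨DopeWolfe.exists_isDOptimal x hπ₀ hps, fun πs hs δ₀ hδ₀ ε hε =>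
    ⟨DopeWolfe.iterationBound_le (hδ₀ ▸ sub_nonneg.2 (hs.le _ hπ₀ hps)) hε,
      fun T hT => ?_⟩⟩
  obtain ⟨tol₀, htol₀, hgap⟩ : ∃ tol₀ : ℝ, 0 < tol₀ ∧ ∀ tol : ℝ, 0 < tol → tol ≤ tol₀ →
      ∀ (Ω : Type _) [MeasurableSpace Ω] (μ : Measure Ω) [IsProbabilityMeasure μ]
        (samples : ℕ → Ω → Finset (DopeWolfe.KSubset N K))
        (chosen : ℕ → Ω → DopeWolfe.KSubset N K),
        DopeWolfe.IsRun x R π₀ 0 tol μ samples chosen →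
        ∫ ω, (DopeWolfe.objective x πs - DopeWolfe.objective x
          (DopeWolfe.stateAt x π₀ 0 tol (fun i => chosen i ω) T).iter) ∂μ ≤ ε := by
    -- For d = 0 the constant b vanishes and the recursion argument does not apply, but the empty
    -- determinant is 1 and g is identically 0.
    rcases Nat.eq_zero_or_pos d with rfl | hd
    · exact ⟨1, one_pos, fun tol _ _ Ω _ μ _ samples chosen _ => by
        simpa [DopeWolfe.objective] using hε.le⟩
    · subst hδ₀
      exact DopeWolfe.exists_tolerance_expected_gap_le hR hRN hd hπ₀ hps hs hε hT
  refine ⟨tol₀, htol₀, fun tol h0 h1 Ω _ μ _ samples chosen hrun => ?_⟩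
  have hint := DopeWolfe.integrable_objective hrun T
  refine ⟨Filter.Eventually.of_forall fun ω => ?_, hint, ?_⟩
  · have hv := DopeWolfe.stateAt_valid hπ₀ hps tol (fun i => chosen i ω) T
    exact ⟨hv.mem, hv.posDef⟩
  · have h := hgap tol h0 h1 Ω μ samples chosen hrun
    rw [integral_sub (integrable_const _) hint, integral_const] at h
    simpa using h
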